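/- Let $\hbar,M,L>0$, $\nu,\beta\ge 0$, $m\in\mathbb N=\{0,1,2,\dots\}$, $\mathcal H=L^2([0,L],dx)$ with inner product antilinear in the first argument, and $\varepsilon_0=\hbar^2\pi^2/(2ML^2)$. For $n\in\mathbb N$ put $$E_n=\varepsilon_0\Big((n+\nu+1)^2-\frac{\beta^2}{(n+\nu+1)^2}\Big),\qquad \phi_n(x)=K_n\,\sin^{\nu+n+1}\!\Big(\frac{\pi x}{L}\Big)\,e^{-\frac{\beta\pi x}{L(\nu+n+1)}}\,P_n^{(a_n,\bar a_n)}\Big(i\cot\frac{\pi x}{L}\Big),\qquad a_n=-(n+\nu+1)+\frac{i\beta}{n+\nu+1},$$ where $P_n^{(a,b)}$ is the Jacobi polynomial and $K_n>0$ makes $\|\phi_n\|=1$. Define recursively, for $m=0,1,2,\dots$, on $(0,L)$, $$\phi_0^{(m)}=\frac{A_{m-1}\cdots A_1A_0\,\phi_m}{\sqrt{(2M)^m\prod_{k=0}^{m-1}(E_m-E_k)}},\qquad W_m=-\hbar\,\frac{(\phi_0^{(m)})'}{\phi_0^{(m)}},\qquad A_m=\hbar\frac{d}{dx}+W_m$$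 (so $\phi_0^{(0)}=\phi_0$), the domain of $A_m$ being the set of $f\in\mathcal H$ that are locally absolutely continuous on $(0,L)$ with $A_mf\in\mathcal H$. For $(q,p)\in\mathcal K=(0,L)\times\mathbb R$ define the coherent state $$\eta_{q,p}(x)=\mathcal R_m(q)\,\exp\Big(\frac{(W_m(q)+ip)x}{\hbar}\Big)\,\phi_0^{(m)}(x),\qquad \mathcal R_m(q)=\Big(\int_0^L\Big|e^{W_m(q)x/\hbar}\,\phi_0^{(m)}(x)\Big|^2dx\Big)^{-1/2},$$ and write $\eta_{q,p}=\eta_{q,p}^{[m,\nu,\beta]}$ when the dependence on the parameters matters. Then every $\eta_{q,p}$ is a vector of $\mathcal H$ in the domain of $A_m$, with $A_m\eta_{q,p}=(W_m(q)+ip)\,\eta_{q,p}$ on $(0,L)$, and the coherent states 1. are normalized: $\langle\eta_{q,p}|\eta_{q,p}\rangle=1$; 2. are not orthogonal to each other: for all $\nu,\beta,\nu',\beta'\ge0$ and all $(q,p),(q',p')\in\mathcal K$ the scalar product $\langle\eta_{q',p'}^{[m,\nu',\beta']}|\eta_{q,p}^{[m,\nu,\beta]}\rangle$ is nonzero, except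 exactly when $(\nu+m+1)\cot\frac{\pi q}{L}+(\nu'+m+1)\cot\frac{\pi q'}{L}=0$ and $|p-p'|\,L=\pi\hbar\,(\nu+\nu'+2m+4+2k)$ for some $k\in\mathbb N$; 3. are continuous in $(q,p)$: the map $\mathcal K\to\mathcal H$, $(q,p)\mapsto\eta_{q,p}$, is continuous for the norm of $\mathcal H$; 4. resolve the identity, $\int_{\mathcal K}\frac{dq\,dp}{2\pi\hbar}\,|\eta_{q,p}\rangle\langle\eta_{q,p}|=\mathbf 1$ in the weak sense: for all $\varphi,\psi\in\mathcal H$ the function $(q,p)\mapsto\langle\varphi|\eta_{q,p}\rangle\langle\eta_{q,p}|\psi\rangle$ is integrable on $\mathcal K$ and $\frac1{2\pi\hbar}\int_{\mathcal K}\langle\varphi|\eta_{q,p}\rangle\langle\eta_{q,p}|\psi\rangle\,dq\,dp=\langle\varphi|\psi\rangle$. -/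

import Mathlib

open MeasureTheory Set

noncomputable section

namespace PoschlTeller

/-- The Jacobi polynomial `P_n^{(a,b)}(z)` with complex parameters, through the standard formula
`P_n^{(a,b)}(z) = (1/n!) ∑_k C(n,k) (n+a+b+1)_k (a+k+1)_{n-k} ((z-1)/2)^k`,
where `(c)_k = c (c+1) ⋯ (c+k-1)`. -/
def jacobiP (n : ℕ) (a b z : ℂ) : ℂ :=
  (1 / (n.factorial : ℂ)) * ∑ k ∈ Finset.range (n + 1),
    (n.choose k : ℂ) * (ascPochhammer ℂ k).eval (n + a + b + 1)
      * (ascPochhammer ℂ (n - k)).eval (a + k + 1) * ((z - 1) / 2) ^ k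

/-- The Hilbert space `L²([0,L], dx)`; its inner product is conjugate-linear in the first
argument. -/
abbrev Hilb (L : ℝ) : Type := Lp ℂ 2 (volume.restrict (Icc (0 : ℝ) L))

/-- A function is an element of the Hilbert space. -/
def IsState (L : ℝ) (f : ℝ → ℂ) : Prop := MemLp f 2 (volume.restrict (Icc (0 : ℝ) L))

open Classical in
/-- The vector of `L²([0,L], dx)` given by a square-integrable function (and `0` for a function
that is not square-integrable). -/
def toHilb (L : ℝ) (f : ℝ → ℂ) : Hilb L :=
  if h : MemLp f 2 (volume.restrict (Icc (0 : ℝ) L)) then h.toLp f else 0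

/-- The energy scale `ε₀ = ħ² π² / (2 M L²)`. -/
def energyScale (ħ M L : ℝ) : ℝ := ħ ^ 2 * Real.pi ^ 2 / (2 * M * L ^ 2)

/-- The eigenvalue `E_n = ε₀ ((n+ν+1)² - β²/(n+ν+1)²)` of the Pöschl-Teller Hamiltonian. -/
def energy (ħ M L ν β : ℝ) (n : ℕ) : ℝ :=
  energyScale ħ M L * ((n + ν + 1) ^ 2 - β ^ 2 / (n + ν + 1) ^ 2)

/-- The parameter `a_n = -(n+ν+1) + i β/(n+ν+1)`. -/
def jacobiParam (ν β : ℝ) (n : ℕ) : ℂ :=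
  -(n + ν + 1) + Complex.I * (β / (n + ν + 1))

/-- The eigenfunction of the Pöschl-Teller Hamiltonian of index `n`, not yet normalized:
`sin^{ν+n+1}(πx/L) exp(-βπx/(L(ν+n+1))) P_n^{(a_n, conj a_n)}(i cot(πx/L))`. -/
def basePhiRaw (L ν β : ℝ) (n : ℕ) (x : ℝ) : ℂ :=
  ((Real.sin (Real.pi * x / L) ^ (ν + n + 1) : ℝ) : ℂ)
    * ((Real.exp (-(β * Real.pi * x) / (L * (ν + n + 1))) : ℝ) : ℂ)
    * jacobiP n (jacobiParam ν β n) (star (jacobiParam ν β n))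
        (Complex.I * (Real.cot (Real.pi * x / L) : ℂ))

/-- The normalization constant `K_n > 0` of the eigenfunction of index `n`. -/
def normConst (L ν β : ℝ) (n : ℕ) : ℝ :=
  (Real.sqrt (∫ x in (0 : ℝ)..L, ‖basePhiRaw L ν β n x‖ ^ 2))⁻¹

/-- The normalized eigenfunction `φ_n` of the Pöschl-Teller Hamiltonian. -/
def basePhi (L ν β : ℝ) (n : ℕ) (x : ℝ) : ℂ :=
  (normConst L ν β n : ℂ) * basePhiRaw L ν β n x

/-- The first order differential expression `ħ d/dx + W`. -/
def firstOrder (ħ : ℝ) (W : ℝ → ℂ) (f : ℝ → ℂ) (x : ℝ) : ℂ :=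
  ħ * deriv f x + W x * f x

/-- The superpotential `-ħ g'/g` of a ground state `g`. -/
def superpotOf (ħ : ℝ) (g : ℝ → ℂ) (x : ℝ) : ℂ := -ħ * deriv g x / g x

/-- The constant `sqrt ((2M)^m ∏_{k<m} (E_{n+m} - E_k))` by which the image of `φ_{n+m}` under
`A_{m-1} ⋯ A_0` is divided. -/
def hierNorm (ħ M L ν β : ℝ) (m n : ℕ) : ℝ :=
  Real.sqrt ((2 * M) ^ m
    * ∏ k ∈ Finset.range m, (energy ħ M L ν β (n + m) - energy ħ M L ν β k))

/-- The product `A_{m-1} ⋯ A_1 A_0` of the first order operators of the hierarchy. Here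
`A_m = ħ d/dx + W_m`, where `W_m` is the superpotential of the ground state
`φ_0^{(m)} = A_{m-1} ⋯ A_0 φ_m / sqrt ((2M)^m ∏_{k<m} (E_m - E_k))`. -/
def hierOp (ħ M L ν β : ℝ) : ℕ → (ℝ → ℂ) → ℝ → ℂ
  | 0 => fun f => f
  | m + 1 => fun f =>
      firstOrder ħ
        (superpotOf ħ fun x =>
          hierOp ħ M L ν β m (basePhi L ν β (0 + m)) x / (hierNorm ħ M L ν β m 0 : ℂ))
        (hierOp ħ M L ν β m f)

/-- The eigenfunction `φ_n^{(m)}` of the `m`-th Hamiltonian of the hierarchy. -/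
def hierPhi (ħ M L ν β : ℝ) (m n : ℕ) (x : ℝ) : ℂ :=
  hierOp ħ M L ν β m (basePhi L ν β (n + m)) x / (hierNorm ħ M L ν β m n : ℂ)

/-- The superpotential `W_m = -ħ (φ_0^{(m)})' / φ_0^{(m)}`. -/
def superpot (ħ M L ν β : ℝ) (m : ℕ) : ℝ → ℂ := superpotOf ħ (hierPhi ħ M L ν β m 0)

/-- The operator `A_m = ħ d/dx + W_m` of the hierarchy. -/
def opA (ħ M L ν β : ℝ) (m : ℕ) (f : ℝ → ℂ) : ℝ → ℂ := firstOrder ħ (superpot ħ M L ν β m) f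

theorem hierOp_succ (ħ M L ν β : ℝ) (m : ℕ) (f : ℝ → ℂ) :
    hierOp ħ M L ν β (m + 1) f = opA ħ M L ν β m (hierOp ħ M L ν β m f) := rfl

/-- The domain of `A_m`: the square-integrable functions `f` that are (locally) absolutely
continuous on `(0,L)` with `ħ f' + W_m f` square-integrable. -/
structure InDomainA (ħ M L ν β : ℝ) (m : ℕ) (f : ℝ → ℂ) : Prop where
  isState : IsState L f
  ac : ∀ a b : ℝ, 0 < a → a < b → b < L → AbsolutelyContinuousOnInterval f a b
  isState_opA : IsState L (opA ħ M L ν β m f)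

/-- The normalization constant
`R_m(q) = (∫_0^L |exp(W_m(q) x/ħ) φ_0^{(m)}(x)|² dx)^{-1/2}` of the coherent states. -/
def csNorm (ħ M L ν β : ℝ) (m : ℕ) (q : ℝ) : ℝ :=
  (Real.sqrt (∫ x in (0 : ℝ)..L,
    ‖Complex.exp (superpot ħ M L ν β m q * x / ħ) * hierPhi ħ M L ν β m 0 x‖ ^ 2))⁻¹

/-- The eigenvalue `W_m(q) + i p` of `A_m` that labels a coherent state. -/
def csLabel (ħ M L ν β : ℝ) (m : ℕ) (q p : ℝ) : ℂ := superpot ħ M L ν β m q + Complex.I * p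

/-- The coherent state `η_{q,p}(x) = R_m(q) exp((W_m(q) + i p) x/ħ) φ_0^{(m)}(x)`. -/
def csFun (ħ M L ν β : ℝ) (m : ℕ) (q p : ℝ) (x : ℝ) : ℂ :=
  (csNorm ħ M L ν β m q : ℂ) * Complex.exp (csLabel ħ M L ν β m q p * x / ħ)
    * hierPhi ħ M L ν β m 0 x

/-- The coherent state `|η_{q,p}⟩` as a vector of `L²([0,L], dx)`. -/
def cs (ħ M L ν β : ℝ) (m : ℕ) (q p : ℝ) : Hilb L := toHilb L (csFun ħ M L ν β m q p)

/-- The phase space: `0 < q < L`, `p` real (the superpotential is infinite at `q = 0, L`). -/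
def phaseSpace (L : ℝ) : Set (ℝ × ℝ) := Ioo (0 : ℝ) L ×ˢ univ

end PoschlTeller

end

noncomputable section

namespace PoschlTeller

/-! Put `s = ν + m + 1`. Everything rests on the closed form `φ_0^{(m)} = K sin^s(πx/L)
exp(-βπx/(Ls))` with `K ≠ 0`. In the variable `t = (i cot(πx/L) - 1)/2`, `φ_m` is this ground
function times a Jacobi polynomial, and each `A_k` acts on the polynomial factor by `lowerOp`, which
carries solutions of the hypergeometric equation with parameter `d` to solutions with parameter `d -
1` (`hypOp_lowerOp`). Jacobi's equation has `d = m`; after `m` steps `d = 0`, where the only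
polynomial solutions of the available degree are constants. Since `W_k` is itself defined from
`φ_0^{(k)}`, this becomes a strong induction on `m` (`hierPhi_zero_and_superpot`).

In `exp(W_m(q)x/ħ) φ_0^{(m)}(x)` the exponentials containing `β` cancel. Up to a constant phase,
`η_{q,p}` is thus the normalization of `exp(wx) sin^s(πx/L)` with `w = -s(π/L)cot(πq/L) + ip/ħ`
(`exists_csFun_eq`).

Scalar products are then values of `F_r(w) = ∫_0^π sin^r t exp(wt) dt`. Integration by parts gives
`(w² + (r+2)²) F_{r+2} = (r+2)(r+1) F_r`, and `F_{r+2n}(w)/F_{r+2n}(0)` tends to `exp(wπ/2) ≠ 0`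
because `sin^{2n}` concentrates at `π/2`. Hence `F_r` vanishes exactly where some factor `w² +
(r+2+2k)²` does (`sinExpInt_eq_zero_iff`).

For the resolution of the identity, Plancherel in `p` leaves the claim that `∫_0^L |η_{q,p}(x)|² dq
= 1` for each `x`. The substitution `u = -2s cot(πq/L)` and the recurrence reduce it to the Laplace
transform of `1/F_{2s-2}` being a multiple of `sin^{-2s}` on the strip `0 < Re z < π`
(`exists_integral_exp_div_eq`). On the line `Re z = π/2` this is Fourier inversion for `cosh^{-2s}`,
whose transform times `F_{2s-2}(u)` is a constant times `exp(uπ/2)` (`sechInt_mul_sinExpInt`); the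
identity theorem extends it to the strip. The multiple need not be evaluated: integrating the
density over `x` and `q` in both orders forces the value `1`. Polarization gives the sesquilinear
form. -/

/-! ### Jacobi polynomials and the hypergeometric equation -/

open Polynomial in
/-- The Jacobi polynomial `P_n^{(a,b)}(z)` as a polynomial in `(z - 1) / 2`. -/
def jacobiPoly (n : ℕ) (a b : ℂ) : Polynomial ℂ :=
  ∑ k ∈ Finset.range (n + 1), C ((1 / (n.factorial : ℂ)) * ((n.choose k : ℂ)
    * (ascPochhammer ℂ k).eval (n + a + b + 1)
      * (ascPochhammer ℂ (n - k)).eval (a + k + 1))) * X ^ k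

theorem jacobiP_eq_eval (n : ℕ) (a b z : ℂ) :
    jacobiP n a b z = (jacobiPoly n a b).eval ((z - 1) / 2) := by
  simp only [jacobiP, jacobiPoly, Polynomial.eval_finsetSum, Polynomial.eval_mul,
    Polynomial.eval_C, Polynomial.eval_pow, Polynomial.eval_X, Finset.mul_sum]
  exact Finset.sum_congr rfl fun k _ => by ring

theorem coeff_jacobiPoly (n : ℕ) (a b : ℂ) (k : ℕ) :
    (jacobiPoly n a b).coeff k = (1 / (n.factorial : ℂ)) * ((n.choose k : ℂ)
    * (ascPochhammer ℂ k).eval (n + a + b + 1)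
      * (ascPochhammer ℂ (n - k)).eval (a + k + 1)) := by
  simp only [jacobiPoly, Polynomial.finsetSum_coeff, Polynomial.coeff_C_mul, Polynomial.coeff_X_pow,
    mul_ite, mul_one, mul_zero, Finset.sum_ite_eq, Finset.mem_range]
  split_ifs with h
  · rfl
  · rw [Nat.choose_eq_zero_of_lt (by omega)]; simp

theorem natDegree_jacobiPoly_le (n : ℕ) (a b : ℂ) : (jacobiPoly n a b).natDegree ≤ n := by
  rw [Polynomial.natDegree_le_iff_coeff_eq_zero]
  intro k hk
  rw [coeff_jacobiPoly, Nat.choose_eq_zero_of_lt (by exact_mod_cast hk)]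
  simp

theorem coeff_jacobiPoly_recurrence (n : ℕ) (a b : ℂ) (k : ℕ) :
    (k + 1) * (k + 1 + a) * (jacobiPoly n a b).coeff (k + 1)
      = (n - k) * (n + k + a + b + 1) * (jacobiPoly n a b).coeff k := by
  simp only [coeff_jacobiPoly]
  rcases lt_or_ge k n with hk | hk
  · obtain ⟨j, rfl⟩ : ∃ j, n = k + (j + 1) := ⟨n - k - 1, by omega⟩
    have h1 : k + (j + 1) - (k + 1) = j := by omega
    have h2 : k + (j + 1) - k = j + 1 := by omega
    have h3 := Nat.choose_succ_right_eq (k + (j + 1)) k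
    rw [h2] at h3
    have h4 : ((k + (j + 1)).choose (k + 1) : ℂ) * (k + 1) = ((k + (j + 1)).choose k : ℂ) * (j + 1) := by
      exact_mod_cast h3
    rw [h1, h2, ascPochhammer_succ_eval, ascPochhammer_succ_left]
    simp only [Polynomial.eval_mul, Polynomial.eval_X, Polynomial.eval_comp, Polynomial.eval_add,
      Polynomial.eval_one]
    push_cast
    rw [show a + (k : ℂ) + 1 + 1 = a + (k + 1) + 1 by ring]
    linear_combination (k + 1 + a) * (1 / ((k + (j + 1)).factorial : ℂ))
      * (ascPochhammer ℂ k).eval (k + (j + 1) + a + b + 1) * (k + (j + 1) + a + b + 1 + k)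
      * (ascPochhammer ℂ j).eval (a + (k + 1) + 1) * h4
  · rw [Nat.choose_eq_zero_of_lt (by omega : n < k + 1)]
    rcases hk.eq_or_lt with rfl | hk
    · simp
    · rw [Nat.choose_eq_zero_of_lt hk]; simp

open Polynomial in
theorem coeff_X_mul_derivative (Q : Polynomial ℂ) (k : ℕ) :
    (X * derivative Q).coeff k = k * Q.coeff k := by
  cases k with
  | zero => simp
  | succ k => rw [coeff_X_mul, coeff_derivative]; push_cast; ring

open Polynomial in
theorem jacobiPoly_ode (n : ℕ) (a b : ℂ) :
    X * (1 + X) * derivative (derivative (jacobiPoly n a b))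
      + (C (a + 1) + C (a + b + 2) * X) * derivative (jacobiPoly n a b)
      - C (n * (n + a + b + 1)) * jacobiPoly n a b = 0 := by
  set Q := jacobiPoly n a b with hQ
  -- Written through the Euler operator `X d/dX`, the equation involves only the coefficients of
  -- index `k` and `k + 1`, and becomes their recurrence.
  have e : X * (1 + X) * derivative (derivative Q)
      + (C (a + 1) + C (a + b + 2) * X) * derivative Q - C (n * (n + a + b + 1)) * Q
      = X * derivative (derivative Q) + (X * derivative (X * derivative Q) - X * derivative Q)
        + (C (a + 1) * derivative Q + C (a + b + 2) * (X * derivative Q))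
        - C (n * (n + a + b + 1)) * Q := by
    simp only [derivative_mul, derivative_X]; ring
  rw [e]
  ext k
  simp only [coeff_add, coeff_sub, coeff_C_mul, coeff_X_mul_derivative, coeff_derivative, coeff_zero]
  have := coeff_jacobiPoly_recurrence n a b k
  rw [← hQ] at this
  linear_combination this

open Polynomial in
/-- The hypergeometric operator to which the eigenvalue equation of a Hamiltonian of the hierarchy
reduces on polynomials in `(i cot (πx/L) - 1) / 2`. -/
def hypOp (N e d : ℂ) (Q : Polynomial ℂ) : Polynomial ℂ :=
  X * (1 + X) * derivative (derivative Q) + (C (1 - N + e) + C (2 - 2 * N) * X) * derivative Q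
    + C (d * (2 * N - 1 - d)) * Q

open Polynomial in
/-- The first order operator on polynomials in `(i cot (πx/L) - 1) / 2` induced by an operator
`ħ d/dx + W_k` of the hierarchy. -/
def lowerOp (κ d : ℂ) (Q : Polynomial ℂ) : Polynomial ℂ :=
  X * (1 + X) * derivative Q - C d * (X + C κ) * Q

-- The intertwining relation of the hierarchy on polynomial parts. The new equation is a combination
-- of the old one and its derivative; the relation `hκ` removes the remaining multiple of `Q`.
open Polynomial in
theorem hypOp_lowerOp {N e d κ : ℂ} (hκ : 2 * (N - d) * κ = N - d + e) {Q : Polynomial ℂ}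
    (hQ : hypOp N e d Q = 0) : hypOp N e (d - 1) (lowerOp κ d Q) = 0 := by
  have h' := congrArg derivative hQ
  have hC := congrArg (C : ℂ → Polynomial ℂ) hκ
  simp only [hypOp, lowerOp] at *
  simp only [derivative_mul, derivative_X, derivative_C,
    derivative_one, derivative_zero, map_add, map_sub, map_mul, map_one] at *
  simp only [show (C (2 : ℂ) : Polynomial ℂ) = 2 from rfl] at *
  linear_combination X * (1 + X) * h' + (1 + 2 * X - C d * (X + C κ)) * hQ + (C d * Q) * hC

-- The point `0` is singular for the equation, so `Q'` does not contribute there. The value at `0`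
-- can therefore be followed through the hierarchy to show that the final constant is not zero.
open Polynomial in
theorem eval_zero_lowerOp (κ d : ℂ) (Q : Polynomial ℂ) :
    (lowerOp κ d Q).eval 0 = -(d * κ) * Q.eval 0 := by
  simp [lowerOp]

open Polynomial in
theorem natDegree_lowerOp_le (κ d : ℂ) (Q : Polynomial ℂ) {n : ℕ} (h : Q.natDegree ≤ n) :
    (lowerOp κ d Q).natDegree ≤ n + 1 := by
  have e : lowerOp κ d Q
      = X * derivative Q + X * (X * derivative Q) - (C d * (X * Q) + C (d * κ) * Q) := by
    simp only [lowerOp, map_mul]; ring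
  rw [e, natDegree_le_iff_coeff_eq_zero]
  intro k hk
  obtain ⟨k, rfl⟩ : ∃ j, k = j + 1 := ⟨k - 1, by omega⟩
  have h1 : Q.coeff (k + 1) = 0 := coeff_eq_zero_of_natDegree_lt (by omega)
  have h2 : Q.coeff k = 0 := coeff_eq_zero_of_natDegree_lt (by omega)
  simp only [coeff_sub, coeff_add, coeff_C_mul, coeff_X_mul, coeff_X_mul_derivative,
    coeff_derivative, h1, h2]
  simp

open Polynomial in
/-- A polynomial of low degree annihilated by the hypergeometric operator with `d = 0` is
constant. -/
theorem eq_C_of_hypOp_zero {N e : ℂ} {n : ℕ} {Q : Polynomial ℂ} (hd : Q.natDegree ≤ n)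
    (hN : ∀ k : ℕ, 1 ≤ k → k ≤ n → (k : ℂ) ≠ 2 * N - 1) (hQ : hypOp N e 0 Q = 0) :
    Q = C (Q.eval 0) := by
  suffices h : Q.natDegree = 0 by
    rw [natDegree_eq_zero] at h
    obtain ⟨c, rfl⟩ := h
    simp
  by_contra h
  have e1 : hypOp N e 0 Q
      = X * derivative (derivative Q) + (X * derivative (X * derivative Q) - X * derivative Q)
        + (C (1 - N + e) * derivative Q + C (2 - 2 * N) * (X * derivative Q)) := by
    simp only [hypOp, derivative_mul, derivative_X]
    simp; ring
  have h2 := congrArg (fun P => coeff P Q.natDegree) hQ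
  have h3 : Q.coeff (Q.natDegree + 1) = 0 := coeff_eq_zero_of_natDegree_lt (by omega)
  simp only [e1, coeff_add, coeff_sub, coeff_C_mul, coeff_X_mul_derivative, coeff_derivative,
    coeff_zero, h3] at h2
  have h4 : Q.coeff Q.natDegree ≠ 0 := by
    rw [coeff_natDegree, Ne, leadingCoeff_eq_zero]
    rintro rfl
    simp at h
  have h5 : (Q.natDegree : ℂ) ≠ 0 := by exact_mod_cast h
  -- The top coefficient of the equation: the degree must be `0` or `2N - 1`, and `hN` excludes the
  -- second.
  have h6 : (Q.natDegree : ℂ) * Q.coeff Q.natDegree * (Q.natDegree - (2 * N - 1)) = 0 := by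
    linear_combination h2
  exact hN Q.natDegree (by omega) hd (sub_eq_zero.mp ((mul_eq_zero.mp h6).resolve_left
    (mul_ne_zero h5 h4)))

/-! ### Ground functions, superpotentials and the action of `A_k` -/

/-- The variable `(i cot (πx/L) - 1) / 2` of the polynomial part of the eigenfunctions. -/
def cotVar (L x : ℝ) : ℂ := (Complex.I * (Real.cot (Real.pi * x / L) : ℂ) - 1) / 2

/-- The unnormalized ground state `sin^N (πx/L) exp (-βπx/(LN))`. -/
def groundFun (L β N x : ℝ) : ℝ :=
  Real.sin (Real.pi * x / L) ^ N * Real.exp (-(β * Real.pi * x) / (L * N))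

/-- The superpotential `-ħ (π/L) (N cot (πx/L) - β/N)` of `groundFun`. -/
def groundPot (ħ L β N x : ℝ) : ℝ :=
  -ħ * (Real.pi / L) * (N * Real.cot (Real.pi * x / L) - β / N)

theorem sin_pos_of_mem {L x : ℝ} (hx : x ∈ Ioo (0 : ℝ) L) : 0 < Real.sin (Real.pi * x / L) := by
  have hL : 0 < L := hx.1.trans hx.2
  apply Real.sin_pos_of_pos_of_lt_pi
  · have := hx.1; positivity
  · rw [div_lt_iff₀ hL]; exact mul_lt_mul_of_pos_left hx.2 Real.pi_pos

theorem hasDerivAt_cot {t : ℝ} (ht : Real.sin t ≠ 0) :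
    HasDerivAt Real.cot (-(1 + Real.cot t ^ 2)) t := by
  have h : Real.cot = fun t => Real.cos t / Real.sin t := funext fun t => Real.cot_eq_cos_div_sin t
  rw [h]
  refine ((Real.hasDerivAt_cos t).div (Real.hasDerivAt_sin t) ht).congr_deriv ?_
  field_simp
  ring

theorem hasDerivAt_pi_mul_div (L x : ℝ) :
    HasDerivAt (fun x : ℝ => Real.pi * x / L) (Real.pi / L) x := by
  simpa using ((hasDerivAt_id x).const_mul Real.pi).div_const L

theorem hasDerivAt_cot_pi_mul_div {L x : ℝ} (hx : x ∈ Ioo (0 : ℝ) L) :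
    HasDerivAt (fun x : ℝ => Real.cot (Real.pi * x / L))
      (-(1 + Real.cot (Real.pi * x / L) ^ 2) * (Real.pi / L)) x := by
  have h := hasDerivAt_cot (sin_pos_of_mem hx).ne'
  exact h.comp x (hasDerivAt_pi_mul_div L x)

/-- The Riccati equation of the cotangent, with `-(1 + cot²)` factored as `4t(1 + t)`; this is the
origin of the coefficient `X * (1 + X)`. -/
theorem hasDerivAt_cotVar {L x : ℝ} (hx : x ∈ Ioo (0 : ℝ) L) :
    HasDerivAt (cotVar L)
      ((Real.pi / L : ℝ) * (2 * Complex.I * (cotVar L x * (1 + cotVar L x)))) x := by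
  have h := (((hasDerivAt_cot_pi_mul_div hx).ofReal_comp.const_mul Complex.I).sub_const
    (1 : ℂ)).div_const 2
  refine h.congr_deriv ?_
  simp only [cotVar]
  push_cast
  linear_combination (-(Complex.cot (Real.pi * x / L)) ^ 2 * (Real.pi / L) * Complex.I / 2)
    * Complex.I_sq

theorem hasDerivAt_groundFun {L x : ℝ} (hx : x ∈ Ioo (0 : ℝ) L) (β : ℝ) {N : ℝ} (hN : 0 < N) :
    HasDerivAt (groundFun L β N)
      (Real.pi / L * (N * Real.cot (Real.pi * x / L) - β / N) * groundFun L β N x) x := by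
  have hL : 0 < L := hx.1.trans hx.2
  have hs := sin_pos_of_mem hx
  have h1 : HasDerivAt (fun x => Real.sin (Real.pi * x / L))
      (Real.cos (Real.pi * x / L) * (Real.pi / L)) x :=
    (Real.hasDerivAt_sin _).comp x (hasDerivAt_pi_mul_div L x)
  have h2 := h1.rpow_const (p := N) (Or.inl hs.ne')
  have h3 : HasDerivAt (fun x : ℝ => -(β * Real.pi * x) / (L * N)) (-(β * Real.pi) / (L * N)) x := by
    simpa using (((hasDerivAt_id x).const_mul (β * Real.pi)).neg).div_const (L * N)
  refine (h2.mul h3.exp).congr_deriv ?_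
  simp only [groundFun]
  rw [Real.rpow_sub_one hs.ne', Real.cot_eq_cos_div_sin]
  field_simp
  ring

theorem groundFun_pos {L x : ℝ} (hx : x ∈ Ioo (0 : ℝ) L) (β N : ℝ) : 0 < groundFun L β N x :=
  mul_pos (Real.rpow_pos_of_pos (sin_pos_of_mem hx) _) (Real.exp_pos _)

/-- The parameter `κ` of `lowerOp` for the step from index `k` to `k + 1` of the hierarchy. -/
def lowerParam (β N N' : ℝ) : ℂ := 1 / 2 + Complex.I * β / (2 * N * N')

theorem lowerParam_ne_zero (β N N' : ℝ) : lowerParam β N N' ≠ 0 := by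
  intro h
  have := congrArg Complex.re h
  rw [lowerParam, show Complex.I * β / (2 * N * N') = ((β / (2 * N * N') : ℝ) : ℂ) * Complex.I by
    push_cast; ring, Complex.add_re, Complex.re_ofReal_mul] at this
  norm_num at this

theorem eventuallyEq_of_eqOn_Ioo {L x : ℝ} {f g : ℝ → ℂ} (hx : x ∈ Ioo (0 : ℝ) L)
    (h : ∀ x ∈ Ioo (0 : ℝ) L, f x = g x) : f =ᶠ[nhds x] g :=
  Filter.eventuallyEq_of_mem (Ioo_mem_nhds hx.1 hx.2) h

/-- Action of an operator of the hierarchy on a function with polynomial part `Q`. -/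
theorem firstOrder_groundFun_mul {ħ L β N N' : ℝ} (hN : 0 < N) (hN' : 0 < N') {K : ℂ}
    {W f : ℝ → ℂ} {Q : Polynomial ℂ}
    (hf : ∀ x ∈ Ioo (0 : ℝ) L, f x = K * groundFun L β N x * Q.eval (cotVar L x))
    {x : ℝ} (hx : x ∈ Ioo (0 : ℝ) L) (hW : W x = groundPot ħ L β N' x) :
    firstOrder ħ W f x = K * (2 * Complex.I * ħ * (Real.pi / L)) * groundFun L β N x
      * (lowerOp (lowerParam β N N') ((N - N' : ℝ) : ℂ) Q).eval (cotVar L x) := by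
  have hd := (((hasDerivAt_groundFun hx β hN).ofReal_comp).const_mul K).mul
    ((Q.hasDerivAt (cotVar L x)).comp x (hasDerivAt_cotVar hx))
  have h1 : deriv f x = _ := ((eventuallyEq_of_eqOn_Ioo hx hf).hasDerivAt_iff.mpr hd).deriv
  rw [firstOrder, h1, hf x hx, hW]
  simp only [lowerOp, groundPot, lowerParam, Polynomial.eval_sub, Polynomial.eval_mul,
    Polynomial.eval_X, Polynomial.eval_C, Polynomial.eval_add, Polynomial.eval_one]
  have hc : ((Real.cot (Real.pi * x / L) : ℝ) : ℂ) = -Complex.I * (2 * cotVar L x + 1) := by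
    rw [cotVar]
    linear_combination (Real.cot (Real.pi * x / L) : ℂ) * Complex.I_sq
  push_cast at hc ⊢
  rw [hc]
  have hN1 : (N : ℂ) ≠ 0 := by exact_mod_cast hN.ne'
  have hN2 : (N' : ℂ) ≠ 0 := by exact_mod_cast hN'.ne'
  have hI : Complex.I ^ 2 = -1 := Complex.I_sq
  simp only [Function.comp_apply]
  -- The derivative of the ground function cancels `W` up to the difference of two superpotentials,
  -- which is affine in `t`; `lowerParam` is chosen so that it is a multiple of `t + κ`.
  have e1 : (2 * Complex.I) * ((N - N' : ℂ) * (cotVar L x + (1 / 2 + Complex.I * β / (2 * N * N'))))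
    = (N - N') * Complex.I * (2 * cotVar L x + 1) - (β / N' - β / N) := by
    field_simp
    linear_combination ((N - N') * β) * hI
  linear_combination (K * ħ * (Real.pi / L) * groundFun L β N x
    * Polynomial.eval (cotVar L x) Q) * e1

/-! ### The polynomial part along the hierarchy -/

/-- The polynomial part of `A_{j-1} ⋯ A_0 φ_m`. -/
def hierPoly (ν β : ℝ) (m : ℕ) : ℕ → Polynomial ℂ
  | 0 => jacobiPoly m (jacobiParam ν β m) (star (jacobiParam ν β m))
  | j + 1 => lowerOp (lowerParam β (ν + m + 1) (ν + j + 1))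
      (((ν + m + 1) - (ν + j + 1) : ℝ) : ℂ) (hierPoly ν β m j)

theorem star_jacobiParam (ν β : ℝ) (n : ℕ) :
    star (jacobiParam ν β n) = -(n + ν + 1) - Complex.I * (β / (n + ν + 1)) := by
  simp only [jacobiParam, Complex.star_def, map_add, map_neg, map_mul, map_div₀, Complex.conj_I,
    Complex.conj_ofReal, map_natCast, map_one]
  ring

theorem hypOp_hierPoly {ν : ℝ} (hν : 0 ≤ ν) (β : ℝ) (m j : ℕ) :
    hypOp (ν + m + 1) (Complex.I * (β / (m + ν + 1))) (m - j) (hierPoly ν β m j) = 0 := by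
  induction j with
  | zero =>
    have h := jacobiPoly_ode m (jacobiParam ν β m) (star (jacobiParam ν β m))
    rw [star_jacobiParam] at h
    simp only [hierPoly, hypOp]
    rw [star_jacobiParam]
    simp only [Nat.cast_zero, sub_zero]
    rw [← h, jacobiParam, sub_eq_add_neg (_ + _), ← neg_mul, ← Polynomial.C_neg]
    congr 3
    · congr 2
      · ring
      · refine congrArg (DFunLike.coe (Polynomial.C (R := ℂ))) ?_; ring
    · ring
  | succ j ih =>
    simp only [hierPoly]
    have h1 : (ν + j + 1 : ℂ) ≠ 0 := by
      have : (ν + j + 1 : ℝ) ≠ 0 := by positivity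
      exact_mod_cast this
    have h2 : (ν + m + 1 : ℂ) ≠ 0 := by
      have : (ν + m + 1 : ℝ) ≠ 0 := by positivity
      exact_mod_cast this
    have h3 : (m + ν + 1 : ℂ) ≠ 0 := by rwa [add_comm (m : ℂ)]
    rw [show (((ν + m + 1) - (ν + j + 1) : ℝ) : ℂ) = m - j by push_cast; ring]
    rw [show ((m : ℂ) - (j + 1 : ℕ)) = m - j - 1 by push_cast; ring]
    refine hypOp_lowerOp ?_ ih
    rw [show (ν + m + 1 : ℂ) - (m - j) = ν + j + 1 by ring, lowerParam]
    push_cast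
    rw [add_comm (m : ℂ)]
    field_simp

theorem ascPochhammer_eval_ne_zero (n : ℕ) (z : ℂ) (h : ∀ k < n, z + k ≠ 0) :
    (ascPochhammer ℂ n).eval z ≠ 0 := by
  induction n with
  | zero => simp
  | succ n ih =>
    rw [ascPochhammer_succ_eval]
    exact mul_ne_zero (ih fun k hk => h k (by omega)) (h n (by omega))

/-- At `j = 0` the value is `(a_m + 1)_m / m!`, whose factors have real part `k - m - ν < 0`. Each
later step multiplies it by `-(m - j) κ`, and `κ` has real part `1/2`. -/
theorem eval_zero_hierPoly {ν : ℝ} (hν : 0 ≤ ν) (β : ℝ) (m j : ℕ) (hj : j ≤ m) :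
    (hierPoly ν β m j).eval 0 ≠ 0 := by
  induction j with
  | zero =>
    simp only [hierPoly]
    rw [← Polynomial.coeff_zero_eq_eval_zero, coeff_jacobiPoly]
    refine mul_ne_zero (by simp [Nat.factorial_ne_zero]) (mul_ne_zero (by simp) ?_)
    refine ascPochhammer_eval_ne_zero _ _ fun k hk h => ?_
    have h1 := congrArg Complex.re h
    obtain ⟨r, hr⟩ : ∃ r : ℝ, (β / (m + ν + 1) : ℂ) = r := ⟨β / (m + ν + 1), by push_cast; ring⟩
    rw [jacobiParam, hr] at h1
    simp at h1
    have : (k : ℝ) + 1 ≤ m := by exact_mod_cast (by omega : k + 1 ≤ m)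
    linarith
  | succ j ih =>
    simp only [hierPoly, eval_zero_lowerOp]
    refine mul_ne_zero (neg_ne_zero.mpr (mul_ne_zero ?_ (lowerParam_ne_zero _ _ _)))
      (ih (by omega))
    have : (j : ℝ) + 1 ≤ m := by exact_mod_cast hj
    have h2 : (ν + m + 1) - (ν + j + 1) ≠ 0 := by linarith
    exact_mod_cast h2

theorem natDegree_hierPoly_le (ν β : ℝ) (m j : ℕ) : (hierPoly ν β m j).natDegree ≤ m + j := by
  induction j with
  | zero => exact natDegree_jacobiPoly_le _ _ _
  | succ j ih => exact natDegree_lowerOp_le _ _ _ ih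

/-- After `m` steps `d = 0`. The crude degree bound `2m` suffices, because the other exponent `2N -
1 = 2ν + 2m + 1` exceeds it. -/
theorem hierPoly_self {ν : ℝ} (hν : 0 ≤ ν) (β : ℝ) (m : ℕ) :
    hierPoly ν β m m = Polynomial.C ((hierPoly ν β m m).eval 0) := by
  have h := hypOp_hierPoly hν β m m
  rw [sub_self] at h
  refine eq_C_of_hypOp_zero (natDegree_hierPoly_le ν β m m) (fun k _ hk h => ?_) h
  have h1 := congrArg Complex.re h
  simp at h1
  have : (k : ℝ) ≤ m + m := by exact_mod_cast hk
  linarith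

theorem basePhiRaw_eq (L ν β : ℝ) (m : ℕ) (x : ℝ) :
    basePhiRaw L ν β m x = groundFun L β (ν + m + 1) x * (hierPoly ν β m 0).eval (cotVar L x) := by
  simp only [basePhiRaw, hierPoly, groundFun, cotVar, jacobiP_eq_eval, Complex.ofReal_mul]

/-- Conditional on the superpotentials of lower index, which the strong induction below supplies. -/
theorem hierOp_eq_of_superpot {ħ M L ν β : ℝ} (hν : 0 ≤ ν) (m j : ℕ)
    (hW : ∀ k < j, ∀ x ∈ Ioo (0 : ℝ) L,
      superpot ħ M L ν β k x = groundPot ħ L β (ν + k + 1) x) :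
    ∀ x ∈ Ioo (0 : ℝ) L, hierOp ħ M L ν β j (basePhi L ν β m) x
      = normConst L ν β m * (2 * Complex.I * ħ * (Real.pi / L)) ^ j
        * groundFun L β (ν + m + 1) x * (hierPoly ν β m j).eval (cotVar L x) := by
  induction j with
  | zero =>
    intro x _
    simp only [hierOp, basePhi, basePhiRaw_eq]
    ring
  | succ j ih =>
    intro x hx
    rw [hierOp_succ, opA, firstOrder_groundFun_mul (by positivity) (by positivity)
      (ih fun k hk => hW k (by omega)) hx (hW j (by omega) x hx), hierPoly]
    ring

theorem exists_cotVar_eq {L : ℝ} (hL : 0 < L) (r : ℝ) :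
    ∃ x ∈ Ioo (0 : ℝ) L, Real.cot (Real.pi * x / L) = r := by
  refine ⟨L / Real.pi * (Real.pi / 2 - Real.arctan r), ⟨?_, ?_⟩, ?_⟩
  · have := Real.arctan_lt_pi_div_two r
    have := Real.pi_pos
    exact mul_pos (by positivity) (by linarith)
  · have := Real.neg_pi_div_two_lt_arctan r
    have := Real.pi_pos
    rw [div_mul_eq_mul_div, div_lt_iff₀ this]
    exact mul_lt_mul_of_pos_left (by linarith) hL
  · have := Real.pi_pos
    rw [show Real.pi * (L / Real.pi * (Real.pi / 2 - Real.arctan r)) / L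
      = Real.pi / 2 - Real.arctan r by field_simp, Real.cot_eq_cos_div_sin,
      Real.cos_pi_div_two_sub, Real.sin_pi_div_two_sub, ← Real.tan_eq_sin_div_cos, Real.tan_arctan]

theorem exists_eval_cotVar_ne_zero {L : ℝ} (hL : 0 < L) {Q : Polynomial ℂ} (hQ : Q ≠ 0) :
    ∃ x ∈ Ioo (0 : ℝ) L, Q.eval (cotVar L x) ≠ 0 := by
  by_contra! h
  refine hQ (Polynomial.eq_zero_of_infinite_isRoot Q ?_)
  have hinj : Function.Injective fun r : ℝ => (Complex.I * (r : ℂ) - 1) / 2 := by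
    intro r s hrs
    simpa using hrs
  refine (Set.infinite_range_of_injective hinj).mono ?_
  rintro _ ⟨r, rfl⟩
  obtain ⟨x, hx, rfl⟩ := exists_cotVar_eq hL r
  exact h x hx

/-! ### Normalization constants and closed forms of the ground states -/

theorem norm_cotVar_le {L x : ℝ} (hx : x ∈ Ioo (0 : ℝ) L) :
    ‖cotVar L x‖ ≤ (Real.sin (Real.pi * x / L))⁻¹ := by
  have hs := sin_pos_of_mem hx
  have h1 : |Real.cot (Real.pi * x / L)| ≤ (Real.sin (Real.pi * x / L))⁻¹ := by
    rw [Real.cot_eq_cos_div_sin, abs_div, abs_of_pos hs, div_eq_mul_inv]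
    exact mul_le_of_le_one_left (by positivity) (Real.abs_cos_le_one _)
  have h2 : 1 ≤ (Real.sin (Real.pi * x / L))⁻¹ := (one_le_inv₀ hs).mpr (Real.sin_le_one _)
  rw [cotVar, norm_div]
  calc _ ≤ (‖Complex.I * (Real.cot (Real.pi * x / L) : ℂ)‖ + ‖(1 : ℂ)‖) / ‖(2 : ℂ)‖ := by
        gcongr; exact norm_sub_le _ _
    _ = (|Real.cot (Real.pi * x / L)| + 1) / 2 := by
        rw [norm_mul, Complex.norm_I, Complex.norm_real, Real.norm_eq_abs]; simp
    _ ≤ _ := by linarith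

theorem groundFun_nonneg_le {L x β N : ℝ} (hβ : 0 ≤ β) (hN : 0 ≤ N) (hx : x ∈ Ioo (0 : ℝ) L) :
    groundFun L β N x ≤ Real.sin (Real.pi * x / L) ^ N := by
  have hL : 0 < L := hx.1.trans hx.2
  have hx0 := hx.1
  refine mul_le_of_le_one_right (Real.rpow_nonneg (sin_pos_of_mem hx).le _) ?_
  rw [Real.exp_le_one_iff, neg_div]
  have : 0 ≤ β * Real.pi * x / (L * N) := by positivity
  linarith

/-- A polynomial of degree at most `m` in `t` grows at most like `sin^{-m}` near the ends, which
`sin^{ν+m+1}` absorbs. -/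
theorem exists_norm_basePhiRaw_le {ν β : ℝ} (hν : 0 ≤ ν) (hβ : 0 ≤ β) (L : ℝ) (m : ℕ) :
    ∃ B, ∀ x ∈ Ioo (0 : ℝ) L, ‖basePhiRaw L ν β m x‖ ≤ B := by
  set Q := hierPoly ν β m 0
  refine ⟨∑ k ∈ Finset.range (m + 1), ‖Q.coeff k‖, fun x hx => ?_⟩
  have hs := sin_pos_of_mem hx
  set σ := Real.sin (Real.pi * x / L)
  rw [basePhiRaw_eq, norm_mul, Complex.norm_real, Real.norm_of_nonneg (groundFun_pos hx _ _).le]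
  have hg := groundFun_nonneg_le (N := ν + m + 1) hβ (by positivity) hx
  have hd : Q.natDegree < m + 1 := Nat.lt_succ_of_le (natDegree_hierPoly_le ν β m 0)
  rw [show hierPoly ν β m 0 = Q from rfl, Polynomial.eval_eq_sum_range' hd]
  calc groundFun L β (ν + m + 1) x * ‖∑ k ∈ Finset.range (m + 1), Q.coeff k * cotVar L x ^ k‖
      ≤ σ ^ (ν + m + 1) * ∑ k ∈ Finset.range (m + 1), ‖Q.coeff k‖ * (σ⁻¹) ^ k := by
        gcongr
        refine (norm_sum_le _ _).trans (Finset.sum_le_sum fun k _ => ?_)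
        rw [norm_mul, norm_pow]
        gcongr
        exact norm_cotVar_le hx
    _ ≤ ∑ k ∈ Finset.range (m + 1), ‖Q.coeff k‖ := by
        rw [Finset.mul_sum]
        refine Finset.sum_le_sum fun k hk => ?_
        rw [mul_left_comm]
        refine mul_le_of_le_one_right (norm_nonneg _) ?_
        rw [inv_pow, ← Real.rpow_natCast, ← div_eq_mul_inv, ← Real.rpow_sub hs]
        have : (k : ℝ) ≤ m := by exact_mod_cast Finset.mem_range_succ_iff.mp hk
        exact Real.rpow_le_one hs.le (Real.sin_le_one _) (by linarith)

theorem continuousOn_basePhiRaw {ν : ℝ} (hν : 0 ≤ ν) (L β : ℝ) (m : ℕ) :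
    ContinuousOn (basePhiRaw L ν β m) (Ioo 0 L) := by
  intro x hx
  have h : basePhiRaw L ν β m = fun x => (groundFun L β (ν + m + 1) x : ℂ)
    * (hierPoly ν β m 0).eval (cotVar L x) := funext fun x => basePhiRaw_eq L ν β m x
  rw [h]
  have h1 := (hasDerivAt_groundFun hx β (N := ν + m + 1) (by positivity)).continuousAt
  have h2 := (hasDerivAt_cotVar hx).continuousAt
  exact ((Complex.continuous_ofReal.continuousAt.comp h1).mul
    ((hierPoly ν β m 0).continuous.continuousAt.comp h2)).continuousWithinAt

/-- Integrability matters as much as positivity: the integral of a non-integrable function is `0` by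
convention, and then so is its inverse. -/
theorem normConst_ne_zero {L ν β : ℝ} (hL : 0 < L) (hν : 0 ≤ ν) (hβ : 0 ≤ β) (m : ℕ) :
    normConst L ν β m ≠ 0 := by
  have hc := (continuousOn_basePhiRaw hν L β m).norm.pow 2
  obtain ⟨B, hB⟩ := exists_norm_basePhiRaw_le hν hβ L m
  rw [normConst]
  refine inv_ne_zero (Real.sqrt_pos.mpr ?_).ne'
  rw [intervalIntegral.integral_of_le hL.le, integral_Ioc_eq_integral_Ioo]
  have hint : IntegrableOn (fun x => ‖basePhiRaw L ν β m x‖ ^ 2) (Ioo 0 L) := by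
    refine Integrable.of_bound (hc.aestronglyMeasurable measurableSet_Ioo) (B ^ 2) ?_
    filter_upwards [ae_restrict_mem measurableSet_Ioo] with x hx
    rw [norm_pow, norm_norm]
    exact pow_le_pow_left₀ (norm_nonneg _) (hB x hx) 2
  rw [setIntegral_pos_iff_support_of_nonneg_ae (Filter.Eventually.of_forall fun x => by
    positivity) hint]
  have hQ : hierPoly ν β m 0 ≠ 0 := by
    intro h
    have := eval_zero_hierPoly hν β m 0 (Nat.zero_le m)
    simp [h] at this
  obtain ⟨x, hx, hne⟩ := exists_eval_cotVar_ne_zero hL hQ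
  have hopen := hc.isOpen_inter_preimage isOpen_Ioo (isOpen_compl_singleton (x := (0 : ℝ)))
  rw [inter_comm]
  refine hopen.measure_pos _ ⟨x, hx, ?_⟩
  have : basePhiRaw L ν β m x ≠ 0 := by
    rw [basePhiRaw_eq]
    exact mul_ne_zero (by exact_mod_cast (groundFun_pos hx _ _).ne') hne
  simpa using this

theorem energy_lt {ħ M L ν : ℝ} (hħ : 0 < ħ) (hM : 0 < M) (hL : 0 < L) (hν : 0 ≤ ν) (β : ℝ)
    {k n : ℕ} (hkn : k < n) : energy ħ M L ν β k < energy ħ M L ν β n := by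
  have hε : 0 < energyScale ħ M L := by unfold energyScale; positivity
  have h1 : (k : ℝ) + ν + 1 < n + ν + 1 := by
    have : (k : ℝ) < n := by exact_mod_cast hkn
    linarith
  have h2 : (0 : ℝ) < k + ν + 1 := by positivity
  have h3 : ((k : ℝ) + ν + 1) ^ 2 < (n + ν + 1) ^ 2 := by gcongr
  have h4 : β ^ 2 / ((n : ℝ) + ν + 1) ^ 2 ≤ β ^ 2 / (k + ν + 1) ^ 2 := by gcongr
  exact mul_lt_mul_of_pos_left (by linarith) hε

theorem hierNorm_ne_zero {ħ M L ν : ℝ} (hħ : 0 < ħ) (hM : 0 < M) (hL : 0 < L) (hν : 0 ≤ ν)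
    (β : ℝ) (m : ℕ) : hierNorm ħ M L ν β m 0 ≠ 0 := by
  refine (Real.sqrt_pos.mpr (mul_pos (by positivity) (Finset.prod_pos fun k hk => ?_))).ne'
  rw [Nat.zero_add]
  exact sub_pos.mpr (energy_lt hħ hM hL hν β (Finset.mem_range.mp hk))

theorem superpotOf_eq_groundPot {ħ L β N : ℝ} (hN : 0 < N) {K : ℂ} (hK : K ≠ 0) {f : ℝ → ℂ}
    (hf : ∀ x ∈ Ioo (0 : ℝ) L, f x = K * groundFun L β N x) {x : ℝ} (hx : x ∈ Ioo (0 : ℝ) L) :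
    superpotOf ħ f x = groundPot ħ L β N x := by
  have hd := ((hasDerivAt_groundFun hx β hN).ofReal_comp).const_mul K
  have h1 : deriv f x = _ := ((eventuallyEq_of_eqOn_Ioo hx hf).hasDerivAt_iff.mpr hd).deriv
  have h2 : (groundFun L β N x : ℂ) ≠ 0 := by exact_mod_cast (groundFun_pos hx _ _).ne'
  rw [superpotOf, h1, hf x hx, groundPot]
  push_cast
  field_simp

/-- Closed forms of the ground states and the superpotentials of the hierarchy. -/
theorem hierPhi_zero_and_superpot {ħ M L ν β : ℝ} (hħ : 0 < ħ) (hM : 0 < M) (hL : 0 < L)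
    (hν : 0 ≤ ν) (hβ : 0 ≤ β) (m : ℕ) :
    (∃ K : ℂ, K ≠ 0 ∧ ∀ x ∈ Ioo (0 : ℝ) L,
      hierPhi ħ M L ν β m 0 x = K * groundFun L β (ν + m + 1) x) ∧
    ∀ x ∈ Ioo (0 : ℝ) L, superpot ħ M L ν β m x = groundPot ħ L β (ν + m + 1) x := by
  induction m using Nat.strong_induction_on with
  | _ m ih =>
    have h : ∃ K : ℂ, K ≠ 0 ∧ ∀ x ∈ Ioo (0 : ℝ) L,
        hierPhi ħ M L ν β m 0 x = K * groundFun L β (ν + m + 1) x := by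
      refine ⟨normConst L ν β m * (2 * Complex.I * ħ * (Real.pi / L)) ^ m
        * (hierPoly ν β m m).eval 0 / hierNorm ħ M L ν β m 0, ?_, fun x hx => ?_⟩
      · have h1 := normConst_ne_zero hL hν hβ m
        have h2 := hierNorm_ne_zero hħ hM hL hν β m
        have h3 := eval_zero_hierPoly hν β m m le_rfl
        have h4 : (ħ : ℂ) ≠ 0 := by exact_mod_cast hħ.ne'
        have h5 : (L : ℂ) ≠ 0 := by exact_mod_cast hL.ne'
        have h6 : (Real.pi : ℂ) ≠ 0 := by exact_mod_cast Real.pi_ne_zero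
        refine div_ne_zero (mul_ne_zero (mul_ne_zero (by exact_mod_cast h1) (pow_ne_zero _ ?_)) h3)
          (by exact_mod_cast h2)
        exact mul_ne_zero (mul_ne_zero (mul_ne_zero two_ne_zero Complex.I_ne_zero) h4)
          (div_ne_zero h6 h5)
      · rw [hierPhi, Nat.zero_add, hierOp_eq_of_superpot hν m m (fun k hk => (ih k hk).2) x hx,
          congrArg (Polynomial.eval (cotVar L x)) (hierPoly_self hν β m), Polynomial.eval_C]
        ring
    refine ⟨h, fun x hx => ?_⟩
    obtain ⟨K, hK, hf⟩ := h
    exact superpotOf_eq_groundPot (by positivity) hK hf hx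

/-! ### The vectors `exp(wx) sin^s(πx/L)` -/

/-- The function `exp (w x) sin^s (πx/L)`. -/
def expSin (L s : ℝ) (w : ℂ) (x : ℝ) : ℂ :=
  Complex.exp (w * x) * ((Real.sin (Real.pi * x / L) ^ s : ℝ) : ℂ)

/-- The vector `exp (w x) sin^s (πx/L)` of `L²([0,L], dx)`. -/
def packet (L s : ℝ) (w : ℂ) : Hilb L := toHilb L (expSin L s w)

/-- The integral `∫_0^π sin^r t exp (w t) dt`. -/
def sinExpInt (r : ℝ) (w : ℂ) : ℂ :=
  ∫ t in (0 : ℝ)..Real.pi, ((Real.sin t ^ r : ℝ) : ℂ) * Complex.exp (w * t)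

/-- The exponent `-s (π/L) cot (πq/L) + i p/ħ` of a coherent state. -/
def csExponent (ħ L s q p : ℝ) : ℂ :=
  ((-(s * (Real.pi / L) * Real.cot (Real.pi * q / L)) : ℝ) : ℂ) + Complex.I * p / ħ

theorem continuous_expSin {s : ℝ} (hs : 0 ≤ s) (L : ℝ) (w : ℂ) : Continuous (expSin L s w) := by
  have h1 : Continuous fun x : ℝ => Real.sin (Real.pi * x / L) ^ s :=
    Continuous.rpow_const (by fun_prop) fun _ => Or.inr hs
  unfold expSin
  fun_prop

theorem memLp_of_continuous {L : ℝ} {f : ℝ → ℂ} (hf : Continuous f) :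
    MemLp f 2 (volume.restrict (Icc (0 : ℝ) L)) := by
  obtain ⟨B, hB⟩ := isCompact_Icc.exists_bound_of_continuousOn (s := Icc (0 : ℝ) L) hf.continuousOn
  refine MemLp.of_bound hf.aestronglyMeasurable B ?_
  filter_upwards [ae_restrict_mem measurableSet_Icc] with x hx using hB x hx

theorem memLp_expSin {s : ℝ} (hs : 0 ≤ s) (L : ℝ) (w : ℂ) :
    MemLp (expSin L s w) 2 (volume.restrict (Icc (0 : ℝ) L)) :=
  memLp_of_continuous (continuous_expSin hs L w)

theorem toHilb_eq {L : ℝ} {f : ℝ → ℂ} (h : MemLp f 2 (volume.restrict (Icc (0 : ℝ) L))) :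
    toHilb L f = h.toLp f := by
  rw [toHilb, dif_pos h]

theorem packet_eq {s : ℝ} (hs : 0 ≤ s) (L : ℝ) (w : ℂ) :
    packet L s w = (memLp_expSin hs L w).toLp _ := toHilb_eq _

theorem coeFn_packet {s : ℝ} (hs : 0 ≤ s) (L : ℝ) (w : ℂ) :
    packet L s w =ᵐ[volume.restrict (Icc (0 : ℝ) L)] expSin L s w := by
  rw [packet_eq hs]
  exact MemLp.coeFn_toLp _

theorem integral_Icc_eq {L : ℝ} (hL : 0 ≤ L) (f : ℝ → ℂ) :
    ∫ x in Icc (0 : ℝ) L, f x = ∫ x in (0 : ℝ)..L, f x := by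
  rw [intervalIntegral.integral_of_le hL, integral_Icc_eq_integral_Ioc]

theorem sin_nonneg_of_mem {L x : ℝ} (hL : 0 < L) (hx : x ∈ Icc (0 : ℝ) L) :
    0 ≤ Real.sin (Real.pi * x / L) := by
  apply Real.sin_nonneg_of_nonneg_of_le_pi
  · have := hx.1; positivity
  · rw [div_le_iff₀ hL]; exact mul_le_mul_of_nonneg_left hx.2 Real.pi_pos.le

theorem inner_packet {L s s' : ℝ} (hL : 0 < L) (hs : 0 ≤ s) (hs' : 0 ≤ s') (w w' : ℂ) :
    inner ℂ (packet L s' w') (packet L s w)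
      = (L / Real.pi : ℝ) * sinExpInt (s + s') ((star w' + w) * (L / Real.pi)) := by
  have h1 : inner ℂ (packet L s' w') (packet L s w) = ∫ x in (0 : ℝ)..L,
      (fun t : ℝ => ((Real.sin t ^ (s + s') : ℝ) : ℂ)
        * Complex.exp ((star w' + w) * (L / Real.pi) * t)) (x * (Real.pi / L)) := by
    rw [L2.inner_def, ← integral_Icc_eq hL.le]
    refine integral_congr_ae ?_
    filter_upwards [coeFn_packet hs L w, coeFn_packet hs' L w',
      ae_restrict_mem measurableSet_Icc] with x h1 h2 hx
    have h0 := sin_nonneg_of_mem hL hx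
    rw [h1, h2, expSin, expSin, RCLike.inner_apply, map_mul, ← Complex.exp_conj, map_mul,
      Complex.conj_ofReal, Complex.conj_ofReal]
    rw [show x * (Real.pi / L) = Real.pi * x / L by ring, Real.rpow_add_of_nonneg h0 hs hs',
      show (star w' + w) * (L / Real.pi) * ((Real.pi * x / L : ℝ) : ℂ)
        = w * x + (starRingEnd ℂ) w' * x by
        have : (L : ℂ) ≠ 0 := by exact_mod_cast hL.ne'
        have : (Real.pi : ℂ) ≠ 0 := by exact_mod_cast Real.pi_ne_zero
        push_cast
        rw [Complex.star_def]
        field_simp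
        ring, Complex.exp_add]
    push_cast
    ring
  have hc : Real.pi / L ≠ 0 := by have := Real.pi_pos; positivity
  rw [h1, intervalIntegral.integral_comp_mul_right (fun t : ℝ => ((Real.sin t ^ (s + s') : ℝ) : ℂ)
    * Complex.exp ((star w' + w) * (L / Real.pi) * t)) hc, sinExpInt, zero_mul,
    mul_div_cancel₀ _ hL.ne', inv_div, Complex.real_smul]

theorem packet_ne_zero {L s : ℝ} (hL : 0 < L) (hs : 0 ≤ s) (w : ℂ) : packet L s w ≠ 0 := by
  intro h
  have h1 := coeFn_packet hs L w
  rw [h] at h1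
  have h2 : ∀ᵐ x ∂(volume.restrict (Ioo (0 : ℝ) L)), False := by
    filter_upwards [ae_restrict_of_ae_restrict_of_subset Ioo_subset_Icc_self h1,
      ae_restrict_of_ae_restrict_of_subset Ioo_subset_Icc_self (Lp.coeFn_zero ℂ 2
      (volume.restrict (Icc (0 : ℝ) L))), ae_restrict_mem measurableSet_Ioo] with x h3 h4 hx
    rw [h4] at h3
    refine mul_ne_zero (Complex.exp_ne_zero _) ?_ h3.symm
    exact_mod_cast (Real.rpow_pos_of_pos (sin_pos_of_mem hx) s).ne'
  rw [Filter.eventually_false_iff_eq_bot, ae_eq_bot, Measure.restrict_eq_zero] at h2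
  simp at h2
  linarith

theorem norm_packet_congr {L s : ℝ} (hL : 0 < L) (hs : 0 ≤ s) {w w' : ℂ} (h : w.re = w'.re) :
    ‖packet L s w‖ = ‖packet L s w'‖ := by
  have h1 := inner_packet hL hs hs w w
  have h2 := inner_packet hL hs hs w' w'
  have h3 : star w + w = star w' + w' := by
    rw [Complex.star_def, add_comm, Complex.add_conj, add_comm,
      Complex.add_conj, h]
  rw [h3, ← h2, inner_self_eq_norm_sq_to_K, inner_self_eq_norm_sq_to_K] at h1
  have h4 : ‖packet L s w‖ ^ 2 = ‖packet L s w'‖ ^ 2 := by exact_mod_cast h1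
  exact (pow_left_inj₀ (norm_nonneg _) (norm_nonneg _) two_ne_zero).mp h4

theorem continuous_packet {L s : ℝ} (hL : 0 < L) (hs : 0 ≤ s) : Continuous (packet L s) := by
  rw [continuous_iff_continuousAt]
  intro w₀
  rw [ContinuousAt, tendsto_iff_norm_sub_tendsto_zero]
  -- The constant turning a uniform bound on `[0,L]` into an `L²` bound.
  set c : ℝ := measureUnivNNReal (volume.restrict (Icc (0 : ℝ) L)) ^ (2 : ENNReal).toReal⁻¹
  have hlim : Filter.Tendsto
      (fun w : ℂ => c * (Real.exp (‖w₀‖ * L) * (2 * (‖w - w₀‖ * L)))) (nhds w₀) (nhds 0) := by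
    have : Continuous fun w : ℂ => c * (Real.exp (‖w₀‖ * L) * (2 * (‖w - w₀‖ * L))) := by fun_prop
    simpa using this.tendsto w₀
  refine squeeze_zero' (Filter.Eventually.of_forall fun _ => norm_nonneg _) ?_ hlim
  -- The range in which `‖exp z - 1‖ ≤ 2‖z‖` applies to `z = (w - w₀)x` for all `x` in `[0,L]`.
  have hnear : ∀ᶠ w in nhds w₀, ‖w - w₀‖ * L < 1 := by
    have : Continuous fun w : ℂ => ‖w - w₀‖ * L := by fun_prop
    exact this.tendsto w₀ (Iio_mem_nhds (by simp))
  filter_upwards [hnear] with w hw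
  refine Lp.norm_le_of_ae_bound (by positivity) ?_
  filter_upwards [coeFn_packet hs L w, coeFn_packet hs L w₀, Lp.coeFn_sub (packet L s w)
    (packet L s w₀), ae_restrict_mem measurableSet_Icc] with x h1 h2 h3 hx
  rw [h3, Pi.sub_apply, h1, h2, expSin, expSin, ← sub_mul, norm_mul, Complex.norm_real,
    Real.norm_of_nonneg (Real.rpow_nonneg (sin_nonneg_of_mem hL hx) _)]
  refine (mul_le_of_le_one_right (norm_nonneg _) (Real.rpow_le_one (sin_nonneg_of_mem hL hx)
    (Real.sin_le_one _) hs)).trans ?_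
  have hxn : ‖(x : ℂ)‖ ≤ L := by
    rw [Complex.norm_real, Real.norm_of_nonneg hx.1]; exact hx.2
  rw [show Complex.exp (w * x) - Complex.exp (w₀ * x)
    = Complex.exp (w₀ * x) * (Complex.exp ((w - w₀) * x) - 1) by
      rw [mul_sub, ← Complex.exp_add, mul_one]; ring_nf, norm_mul]
  have hsmall : ‖(w - w₀) * x‖ ≤ ‖w - w₀‖ * L := by
    rw [norm_mul]; gcongr
  gcongr
  · rw [Complex.norm_exp]
    gcongr
    exact (Complex.re_le_norm _).trans (by rw [norm_mul]; gcongr)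
  · exact (Complex.norm_exp_sub_one_le (hsmall.trans hw.le)).trans (by gcongr)

/-! ### Explicit coherent states: normalization, continuity, eigenvalue equation -/

/-- A coherent state is, up to a constant phase, the normalization of a vector `packet`. -/
theorem exists_csFun_eq {ħ M L ν β : ℝ} (hħ : 0 < ħ) (hM : 0 < M) (hL : 0 < L)
    (hν : 0 ≤ ν) (hβ : 0 ≤ β) (m : ℕ) :
    ∃ u : ℂ, ‖u‖ = 1 ∧ ∀ q ∈ Ioo (0 : ℝ) L, ∀ p : ℝ, ∀ x ∈ Ioo (0 : ℝ) L,
      csFun ħ M L ν β m q p x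
        = u * ((‖packet L (ν + m + 1) (csExponent ħ L (ν + m + 1) q p)‖⁻¹ : ℝ) : ℂ)
          * expSin L (ν + m + 1) (csExponent ħ L (ν + m + 1) q p) x := by
  obtain ⟨⟨K, hK, hphi⟩, hW⟩ := hierPhi_zero_and_superpot (M := M) hħ hM hL hν hβ m
  set s := ν + m + 1 with hsdef
  have hs : 0 < s := by positivity
  have hKn : (‖K‖ : ℂ) ≠ 0 := by exact_mod_cast norm_ne_zero_iff.mpr hK
  -- The term `ħπβ/(Ls)` of `W_m(q)` produces exactly the inverse of the exponential factor of the
  -- ground state, so `β` survives only in `K`.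
  have key : ∀ q ∈ Ioo (0 : ℝ) L, ∀ p : ℝ, ∀ x ∈ Ioo (0 : ℝ) L,
      Complex.exp ((superpot ħ M L ν β m q + Complex.I * p) * x / ħ) * hierPhi ħ M L ν β m 0 x
        = K * expSin L s (csExponent ħ L s q p) x := by
    intro q hq p x hx
    have h1 : (superpot ħ M L ν β m q + Complex.I * p) * x / ħ
        = csExponent ħ L s q p * x - ((-(β * Real.pi * x) / (L * s) : ℝ) : ℂ) := by
      have h1 : (L : ℂ) ≠ 0 := by exact_mod_cast hL.ne'
      have h2 : (ħ : ℂ) ≠ 0 := by exact_mod_cast hħ.ne'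
      have h3 : (s : ℂ) ≠ 0 := by exact_mod_cast hs.ne'
      rw [hW q hq, groundPot, csExponent]
      push_cast
      field_simp
      ring
    rw [h1, hphi x hx, expSin, groundFun, Complex.exp_sub, Complex.ofReal_mul, Complex.ofReal_exp]
    field_simp
  have hnorm : ∀ q ∈ Ioo (0 : ℝ) L, ∀ p : ℝ,
      csNorm ħ M L ν β m q = ‖K‖⁻¹ * ‖packet L s (csExponent ħ L s q p)‖⁻¹ := by
    intro q hq p
    have h0 : (csExponent ħ L s q p).re = (csExponent ħ L s q 0).re := by
      simp [csExponent, Complex.add_re, Complex.div_ofReal_re]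
    rw [norm_packet_congr hL hs.le h0, csNorm, ← mul_inv]
    congr 1
    rw [Real.sqrt_eq_iff_mul_self_eq (intervalIntegral.integral_nonneg hL.le fun x _ => by
      positivity) (by positivity), ← pow_two, mul_pow]
    have h1 : ((‖packet L s (csExponent ħ L s q 0)‖ ^ 2 : ℝ) : ℂ)
        = ((∫ x in (0 : ℝ)..L, ‖expSin L s (csExponent ħ L s q 0) x‖ ^ 2 : ℝ) : ℂ) := by
      rw [← intervalIntegral.integral_ofReal, ← integral_Icc_eq hL.le]
      have h2 := inner_self_eq_norm_sq_to_K (𝕜 := ℂ) (packet L s (csExponent ħ L s q 0))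
      push_cast
      refine h2.symm.trans ?_
      rw [L2.inner_def]
      refine integral_congr_ae ?_
      filter_upwards [coeFn_packet hs.le L (csExponent ħ L s q 0)] with x hx
      rw [hx, inner_self_eq_norm_sq_to_K]
      norm_cast
    rw [Complex.ofReal_injective h1, ← intervalIntegral.integral_const_mul,
      intervalIntegral.integral_of_le hL.le, intervalIntegral.integral_of_le hL.le,
      integral_Ioc_eq_integral_Ioo, integral_Ioc_eq_integral_Ioo]
    refine setIntegral_congr_fun measurableSet_Ioo fun x hx => ?_
    have h3 := key q hq 0 x hx
    rw [Complex.ofReal_zero, mul_zero, add_zero] at h3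
    rw [h3, norm_mul, mul_pow]
  -- The normalization removes the modulus of `K` and leaves its phase, which does not depend on
  -- `(q, p)`.
  refine ⟨K / ‖K‖, ?_, fun q hq p x hx => ?_⟩
  · rw [norm_div, Complex.norm_real, norm_norm, div_self (norm_ne_zero_iff.mpr hK)]
  · rw [csFun, csLabel, mul_assoc, key q hq p x hx, hnorm q hq p]
    push_cast
    field_simp

theorem exists_cs_eq {ħ M L ν β : ℝ} (hħ : 0 < ħ) (hM : 0 < M) (hL : 0 < L)
    (hν : 0 ≤ ν) (hβ : 0 ≤ β) (m : ℕ) :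
    ∃ u : ℂ, ‖u‖ = 1 ∧ ∀ q ∈ Ioo (0 : ℝ) L, ∀ p : ℝ,
      IsState L (csFun ħ M L ν β m q p) ∧ cs ħ M L ν β m q p
        = (u * ((‖packet L (ν + m + 1) (csExponent ħ L (ν + m + 1) q p)‖⁻¹ : ℝ) : ℂ)) •
          packet L (ν + m + 1) (csExponent ħ L (ν + m + 1) q p) := by
  obtain ⟨u, hu, h⟩ := exists_csFun_eq hħ hM hL hν hβ m
  refine ⟨u, hu, fun q hq p => ?_⟩
  set s := ν + m + 1 with hsdef
  have hs : 0 ≤ s := by positivity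
  set c := u * ((‖packet L s (csExponent ħ L s q p)‖⁻¹ : ℝ) : ℂ)
  have hae : c • expSin L s (csExponent ħ L s q p)
      =ᵐ[volume.restrict (Icc (0 : ℝ) L)] csFun ħ M L ν β m q p := by
    rw [← restrict_Ioo_eq_restrict_Icc]
    filter_upwards [ae_restrict_mem measurableSet_Ioo] with x hx
    rw [h q hq p x hx, Pi.smul_apply, smul_eq_mul]
  have hmem := (memLp_expSin hs L (csExponent ħ L s q p)).const_smul c
  have hst : IsState L (csFun ħ M L ν β m q p) := hmem.ae_eq hae
  refine ⟨hst, ?_⟩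
  rw [cs, toHilb_eq hst, packet_eq hs, ← MemLp.toLp_const_smul]
  exact MemLp.toLp_congr _ _ hae.symm

theorem continuousOn_csExponent {L : ℝ} (ħ s : ℝ) :
    ContinuousOn (fun z : ℝ × ℝ => csExponent ħ L s z.1 z.2) (phaseSpace L) := by
  have h1 : ContinuousOn (fun q : ℝ => Real.cot (Real.pi * q / L)) (Ioo 0 L) :=
    fun q hq => (hasDerivAt_cot_pi_mul_div hq).continuousAt.continuousWithinAt
  have h2 : ContinuousOn (fun z : ℝ × ℝ => Real.cot (Real.pi * z.1 / L)) (phaseSpace L) :=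
    h1.comp continuousOn_fst fun z hz => hz.1
  unfold csExponent
  have h3 : ContinuousOn (fun z : ℝ × ℝ => -(s * (Real.pi / L) * Real.cot (Real.pi * z.1 / L)))
    (phaseSpace L) := (continuousOn_const.mul h2).neg
  have h4 : ContinuousOn (fun z : ℝ × ℝ => Complex.I * (z.2 : ℂ) / ħ) (phaseSpace L) := by
    fun_prop
  exact (Complex.continuous_ofReal.comp_continuousOn h3).add h4

theorem continuousOn_cs {ħ M L ν β : ℝ} (hħ : 0 < ħ) (hM : 0 < M) (hL : 0 < L)
    (hν : 0 ≤ ν) (hβ : 0 ≤ β) (m : ℕ) :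
    ContinuousOn (fun z : ℝ × ℝ => cs ħ M L ν β m z.1 z.2) (phaseSpace L) := by
  obtain ⟨u, -, h⟩ := exists_cs_eq hħ hM hL hν hβ m
  have hs : 0 ≤ ν + m + 1 := by positivity
  have h1 : ContinuousOn (fun z : ℝ × ℝ =>
      packet L (ν + m + 1) (csExponent ħ L (ν + m + 1) z.1 z.2)) (phaseSpace L) :=
    (continuous_packet hL hs).comp_continuousOn (continuousOn_csExponent ħ _)
  have h2 := h1.norm.inv₀ fun z _ => norm_ne_zero_iff.mpr (packet_ne_zero hL hs _)
  refine ContinuousOn.congr ((continuousOn_const (c := u)).mul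
    (Complex.continuous_ofReal.comp_continuousOn h2) |>.smul h1) fun z hz => ?_
  exact (h z.1 hz.1 z.2).2

theorem inner_cs_self {ħ M L ν β : ℝ} (hħ : 0 < ħ) (hM : 0 < M) (hL : 0 < L)
    (hν : 0 ≤ ν) (hβ : 0 ≤ β) (m : ℕ) {q : ℝ} (hq : q ∈ Ioo (0 : ℝ) L) (p : ℝ) :
    inner ℂ (cs ħ M L ν β m q p) (cs ħ M L ν β m q p) = 1 := by
  obtain ⟨u, hu, h⟩ := exists_cs_eq hħ hM hL hν hβ m
  have h0 := norm_ne_zero_iff.mpr (packet_ne_zero hL (by positivity : 0 ≤ ν + m + 1)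
    (csExponent ħ L (ν + m + 1) q p))
  rw [inner_self_eq_norm_sq_to_K, (h q hq p).2, norm_smul, norm_mul, hu, Complex.norm_real,
    norm_inv, norm_norm, one_mul, inv_mul_cancel₀ h0]
  simp

/-- The ground state solves `ħ f' = -W_m f`, and the exponential factor adds the label. The
derivative is continuous on `(0,L)`, hence absolute continuity on compact subintervals; `A_m η` is a
multiple of `η`, hence square-integrable. -/
theorem cs_eigen {ħ M L ν β : ℝ} (hħ : 0 < ħ) (hM : 0 < M) (hL : 0 < L)
    (hν : 0 ≤ ν) (hβ : 0 ≤ β) (m : ℕ) {q : ℝ} (hq : q ∈ Ioo (0 : ℝ) L) (p : ℝ) :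
    InDomainA ħ M L ν β m (csFun ħ M L ν β m q p) ∧
      ∀ x ∈ Ioo (0 : ℝ) L, opA ħ M L ν β m (csFun ħ M L ν β m q p) x
          = csLabel ħ M L ν β m q p * csFun ħ M L ν β m q p x := by
  obtain ⟨⟨K, hK, hphi⟩, hW⟩ := hierPhi_zero_and_superpot (M := M) hħ hM hL hν hβ m
  set s := ν + m + 1 with hsdef
  have hs : 0 < s := by positivity
  have hħ' : (ħ : ℂ) ≠ 0 := by exact_mod_cast hħ.ne'
  have hderiv : ∀ x ∈ Ioo (0 : ℝ) L, HasDerivAt (csFun ħ M L ν β m q p)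
      ((csLabel ħ M L ν β m q p - groundPot ħ L β s x) / ħ * csFun ħ M L ν β m q p x) x := by
    intro x hx
    have h1 : HasDerivAt (fun x : ℝ => Complex.exp (csLabel ħ M L ν β m q p * x / ħ))
        (Complex.exp (csLabel ħ M L ν β m q p * x / ħ) * (csLabel ħ M L ν β m q p / ħ)) x := by
      have := ((Complex.ofRealCLM.hasDerivAt (x := x)).const_mul
        (csLabel ħ M L ν β m q p)).div_const (ħ : ℂ)
      simpa using this.cexp
    have h2 := (h1.const_mul (csNorm ħ M L ν β m q : ℂ)).mul
      (((hasDerivAt_groundFun hx β hs).ofReal_comp).const_mul K)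
    have h3 : csFun ħ M L ν β m q p =ᶠ[nhds x] fun x => csNorm ħ M L ν β m q
        * Complex.exp (csLabel ħ M L ν β m q p * x / ħ) * (K * groundFun L β s x) := by
      refine eventuallyEq_of_eqOn_Ioo hx fun y hy => ?_
      rw [csFun, hphi y hy]
    refine (h3.hasDerivAt_iff.mpr h2).congr_deriv ?_
    rw [h3.eq_of_nhds, groundPot]
    push_cast
    field_simp
    ring
  have heig : ∀ x ∈ Ioo (0 : ℝ) L, opA ħ M L ν β m (csFun ħ M L ν β m q p) x
          = csLabel ħ M L ν β m q p * csFun ħ M L ν β m q p x := by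
    intro x hx
    rw [opA, firstOrder, (hderiv x hx).deriv, hW x hx]
    field_simp
    ring
  obtain ⟨u, -, hcs⟩ := exists_cs_eq hħ hM hL hν hβ m
  have hst := (hcs q hq p).1
  refine ⟨⟨hst, fun a b ha hab hb => ?_, ?_⟩, heig⟩
  · have hsub : uIcc a b ⊆ Ioo 0 L := by
      rw [uIcc_of_le hab.le]
      exact fun x hx => ⟨ha.trans_le hx.1, hx.2.trans_lt hb⟩
    have hcont : ContinuousOn (fun x => (csLabel ħ M L ν β m q p - groundPot ħ L β s x) / ħ
        * csFun ħ M L ν β m q p x) (Ioo 0 L) := by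
      have h1 : ContinuousOn (groundPot ħ L β s) (Ioo 0 L) := fun x hx =>
        (((continuousAt_const.mul (hasDerivAt_cot_pi_mul_div hx).continuousAt).sub
          continuousAt_const).const_mul _).continuousWithinAt
      have h2 : ContinuousOn (csFun ħ M L ν β m q p) (Ioo 0 L) := fun x hx =>
        (hderiv x hx).continuousAt.continuousWithinAt
      exact ((continuousOn_const.sub (Complex.continuous_ofReal.comp_continuousOn h1)).div_const
        _).mul h2
    have hC1 : ContDiffOn ℝ 1 (csFun ħ M L ν β m q p) (Ioo 0 L) := by
      rw [show (1 : WithTop ℕ∞) = 0 + 1 by simp, contDiffOn_succ_iff_deriv_of_isOpen isOpen_Ioo]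
      refine ⟨fun x hx => (hderiv x hx).differentiableAt.differentiableWithinAt, by simp, ?_⟩
      rw [contDiffOn_zero]
      exact hcont.congr fun x hx => (hderiv x hx).deriv
    exact (hC1.mono hsub).absolutelyContinuousOnInterval
  · have hae : (fun x => csLabel ħ M L ν β m q p * csFun ħ M L ν β m q p x)
        =ᵐ[volume.restrict (Icc (0 : ℝ) L)] opA ħ M L ν β m (csFun ħ M L ν β m q p) := by
      rw [← restrict_Ioo_eq_restrict_Icc]
      filter_upwards [ae_restrict_mem measurableSet_Ioo] with x hx
      rw [heig x hx]
    exact (hst.const_mul _).ae_eq hae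

/-! ### Zeros of `∫_0^π sin^r t exp(wt) dt` and orthogonality -/

theorem continuous_sinExp {r : ℝ} (hr : 0 ≤ r) (w : ℂ) :
    Continuous fun t : ℝ => ((Real.sin t ^ r : ℝ) : ℂ) * Complex.exp (w * t) := by
  have h1 : Continuous fun x : ℝ => Real.sin x ^ r :=
    Continuous.rpow_const (by fun_prop) fun _ => Or.inr hr
  fun_prop

/-- Two integrations by parts in one: the difference of the two sides is the integral of the
derivative of `exp(wt)((r+2) sin^{r+1} t cos t - w sin^{r+2} t)`, which vanishes at both ends. -/
theorem sinExpInt_add_two {r : ℝ} (hr : 0 ≤ r) (w : ℂ) :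
    (w ^ 2 + (r + 2) ^ 2) * sinExpInt (r + 2) w = (r + 2) * (r + 1) * sinExpInt r w := by
  have hcont : Continuous fun t : ℝ => Complex.exp (w * t) * (((r + 2) * (Real.sin t ^ (r + 1)
      * Real.cos t) : ℝ) - w * ((Real.sin t ^ (r + 2) : ℝ) : ℂ)) := by
    have h1 : Continuous fun x : ℝ => Real.sin x ^ (r + 1) :=
      Continuous.rpow_const (by fun_prop) fun _ => Or.inr (by positivity)
    have h2 : Continuous fun x : ℝ => Real.sin x ^ (r + 2) :=
      Continuous.rpow_const (by fun_prop) fun _ => Or.inr (by positivity)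
    fun_prop
  have hint : Continuous fun t : ℝ =>
      ((r + 2) * (r + 1) : ℂ) * (((Real.sin t ^ r : ℝ) : ℂ) * Complex.exp (w * t))
      - (w ^ 2 + (r + 2) ^ 2) * (((Real.sin t ^ (r + 2) : ℝ) : ℂ) * Complex.exp (w * t)) :=
    (continuous_const.mul (continuous_sinExp hr w)).sub
      (continuous_const.mul (continuous_sinExp (by positivity) w))
  have hFTC := intervalIntegral.integral_eq_sub_of_hasDerivAt_of_le Real.pi_pos.le
    hcont.continuousOn (f' := fun t : ℝ =>
      ((r + 2) * (r + 1) : ℂ) * (((Real.sin t ^ r : ℝ) : ℂ) * Complex.exp (w * t))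
      - (w ^ 2 + (r + 2) ^ 2) * (((Real.sin t ^ (r + 2) : ℝ) : ℂ) * Complex.exp (w * t)))
    (fun t ht => by
      have hs : 0 < Real.sin t := Real.sin_pos_of_pos_of_lt_pi ht.1 ht.2
      have he : HasDerivAt (fun x : ℝ => Complex.exp (w * x)) (Complex.exp (w * t) * w) t := by
        have := (Complex.ofRealCLM.hasDerivAt (x := t)).const_mul w
        simpa using this.cexp
      have h1 := ((Real.hasDerivAt_sin t).rpow_const (p := r + 1) (Or.inl hs.ne')).mul
        (Real.hasDerivAt_cos t)
      have h2 := (Real.hasDerivAt_sin t).rpow_const (p := r + 2) (Or.inl hs.ne')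
      refine (he.mul (((h1.const_mul (r + 2)).ofReal_comp).sub
        (h2.ofReal_comp.const_mul w))).congr_deriv ?_
      have e1 : r + 1 - 1 = r := by ring
      have e2 : r + 2 - 1 = r + 1 := by ring
      have e3 : Real.sin t ^ (r + 2) = Real.sin t ^ r * Real.sin t ^ 2 := by
        exact_mod_cast Real.rpow_add_natCast hs.ne' r 2
      have hcs : ((Real.cos t : ℝ) : ℂ) ^ 2 = 1 - ((Real.sin t : ℝ) : ℂ) ^ 2 := by
        exact_mod_cast Real.cos_sq' t
      rw [e1, e2, Pi.sub_apply, Pi.mul_apply, e3, Real.rpow_add_one hs.ne']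
      simp only [Complex.ofReal_add, Complex.ofReal_mul, Complex.ofReal_neg, Complex.ofReal_pow,
        Complex.ofReal_ofNat, Complex.ofReal_one]
      linear_combination (Complex.exp (w * t) * (r + 2) * (r + 1)
        * ((Real.sin t ^ r : ℝ) : ℂ)) * hcs)
    (hint.intervalIntegrable _ _)
  rw [intervalIntegral.integral_sub 
    (((continuous_sinExp hr w).intervalIntegrable _ _).const_mul _)
    (((continuous_sinExp (by positivity) w).intervalIntegrable _ _).const_mul _),
    intervalIntegral.integral_const_mul, intervalIntegral.integral_const_mul] at hFTC
  have hr1 : r + 1 ≠ 0 := by positivity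
  have hr2 : r + 2 ≠ 0 := by positivity
  simp only [Real.sin_pi, Real.sin_zero, Real.zero_rpow hr1, Real.zero_rpow hr2, zero_mul,
    mul_zero, Complex.ofReal_zero, sub_zero] at hFTC
  exact (sub_eq_zero.mp hFTC).symm

/-- The weights `sin^{2n}`, normalized, concentrate at their unique maximum `π/2`. Dividing by the
value at `w = 0` makes the normalization disappear. -/
theorem tendsto_sinExpInt_div {r : ℝ} (hr : 0 ≤ r) (w : ℂ) :
    Filter.Tendsto (fun n : ℕ => sinExpInt (r + 2 * n) w / sinExpInt (r + 2 * n) 0) Filter.atTop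
      (nhds (Complex.exp (w * (Real.pi / 2)))) := by
  have hI : ∀ (n : ℕ) (w : ℂ), sinExpInt (r + 2 * n) w = ∫ t in Icc (0 : ℝ) Real.pi,
      (Real.sin t ^ 2) ^ n • (((Real.sin t ^ r : ℝ) : ℂ) * Complex.exp (w * t)) := by
    intro n w
    rw [sinExpInt, ← integral_Icc_eq Real.pi_pos.le]
    refine setIntegral_congr_fun measurableSet_Icc fun t ht => ?_
    have hs := Real.sin_nonneg_of_nonneg_of_le_pi ht.1 ht.2
    rw [Real.rpow_add_of_nonneg hs hr (by positivity), ← pow_mul, Complex.real_smul,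
      show (2 * (n : ℝ)) = ((2 * n : ℕ) : ℝ) by push_cast; ring, Real.rpow_natCast]
    push_cast
    ring
  have hlim : ∀ w : ℂ, Filter.Tendsto (fun n : ℕ => (∫ t in Icc (0 : ℝ) Real.pi,
      (Real.sin t ^ 2) ^ n)⁻¹ • sinExpInt (r + 2 * n) w) Filter.atTop
      (nhds (Complex.exp (w * (Real.pi / 2)))) := by
    intro w
    have hpi := Real.pi_pos
    have := tendsto_setIntegral_pow_smul_of_unique_maximum_of_isCompact_of_continuousOn
      (μ := volume) (s := Icc (0 : ℝ) Real.pi) (x₀ := Real.pi / 2) isCompact_Icc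
      (c := fun t => Real.sin t ^ 2)
      (g := fun t : ℝ => ((Real.sin t ^ r : ℝ) : ℂ) * Complex.exp (w * t))
      (by fun_prop) ?_ (fun t _ => sq_nonneg _) (by simp) ?_ (continuous_sinExp hr w).continuousOn
    · simp only [← hI] at this
      simpa using this
    · intro y hy hne
      have hc : Real.cos y ≠ 0 := by
        intro h
        exact hne (Real.injOn_cos hy ⟨by positivity, by linarith⟩ (h.trans Real.cos_pi_div_two.symm))
      have := Real.sin_sq_add_cos_sq y
      have := sq_pos_of_ne_zero hc
      simp only [Real.sin_pi_div_two]
      linarith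
    · rw [interior_Icc, closure_Ioo hpi.ne]
      exact ⟨by positivity, by linarith⟩
  have h := (hlim w).div (hlim 0) (Complex.exp_ne_zero _)
  rw [zero_mul, Complex.exp_zero, div_one] at h
  refine h.congr fun n => ?_
  have hne : (∫ t in Icc (0 : ℝ) Real.pi, (Real.sin t ^ 2) ^ n) ≠ 0 := by
    rw [integral_Icc_eq_integral_Ioc, ← intervalIntegral.integral_of_le Real.pi_pos.le]
    refine (intervalIntegral.intervalIntegral_pos_of_pos_on
      (Continuous.intervalIntegrable (by fun_prop) _ _) (fun t ht => ?_) Real.pi_pos).ne'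
    have := Real.sin_pos_of_pos_of_lt_pi ht.1 ht.2
    positivity
  simp only [Pi.div_apply, Complex.real_smul]
  rw [mul_div_mul_left]
  exact_mod_cast inv_ne_zero hne

/-- If no factor vanishes, a zero propagates to every `r + 2n`, against the nonzero limit. If the
`k`-th factor vanishes, the integral with exponent `r + 2k` is zero, and the recurrence carries this
down to `r`. -/
theorem sinExpInt_eq_zero_iff {r : ℝ} (hr : 0 ≤ r) (w : ℂ) :
    sinExpInt r w = 0 ↔ ∃ k : ℕ, w ^ 2 + (r + 2 + 2 * k : ℂ) ^ 2 = 0 := by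
  have hrec : ∀ n : ℕ, (w ^ 2 + (r + 2 + 2 * n : ℂ) ^ 2) * sinExpInt (r + 2 * (n + 1 : ℕ)) w
      = (((r + 2 * n + 2) * (r + 2 * n + 1) : ℝ) : ℂ) * sinExpInt (r + 2 * n) w := by
    intro n
    have h := sinExpInt_add_two (r := r + 2 * n) (by positivity) w
    rw [show r + 2 * (n : ℝ) + 2 = r + 2 * (n + 1 : ℕ) by push_cast; ring] at h
    push_cast at h ⊢
    rw [← h]
    ring
  have hcoef : ∀ n : ℕ, (((r + 2 * n + 2) * (r + 2 * n + 1) : ℝ) : ℂ) ≠ 0 := fun n => by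
    have : (r + 2 * n + 2) * (r + 2 * n + 1) ≠ 0 := by positivity
    exact_mod_cast this
  constructor
  · intro h0
    by_contra! hne
    have hall : ∀ n : ℕ, sinExpInt (r + 2 * n) w = 0 := by
      intro n
      induction n with
      | zero => simpa using h0
      | succ n ih =>
        have := hrec n
        rw [ih, mul_zero] at this
        exact (mul_eq_zero.mp this).resolve_left (hne n)
    have h := tendsto_sinExpInt_div hr w
    simp only [hall, zero_div] at h
    exact Complex.exp_ne_zero _ (tendsto_nhds_unique tendsto_const_nhds h).symm
  · rintro ⟨k, hk⟩
    have hdown : ∀ n : ℕ, sinExpInt (r + 2 * n) w = 0 → sinExpInt r w = 0 := by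
      intro n
      induction n with
      | zero => intro h; simpa using h
      | succ n ih =>
        intro h
        have := hrec n
        rw [h, mul_zero] at this
        exact ih ((mul_eq_zero.mp this.symm).resolve_left (hcoef n))
    have := hrec k
    rw [hk, zero_mul] at this
    exact hdown k ((mul_eq_zero.mp this.symm).resolve_left (hcoef k))

theorem sq_add_sq_eq_zero_iff {A B ρ : ℝ} (hρ : 0 < ρ) :
    ((A : ℂ) + Complex.I * B) ^ 2 + (ρ : ℂ) ^ 2 = 0 ↔ A = 0 ∧ |B| = ρ := by
  rw [Complex.ext_iff]
  have h1 : (((A : ℂ) + Complex.I * B) ^ 2 + (ρ : ℂ) ^ 2).re = A ^ 2 - B ^ 2 + ρ ^ 2 := by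
    simp [pow_two]
  have h2 : (((A : ℂ) + Complex.I * B) ^ 2 + (ρ : ℂ) ^ 2).im = 2 * (A * B) := by
    simp [pow_two]; ring
  rw [h1, h2, Complex.zero_re, Complex.zero_im]
  constructor
  · rintro ⟨h3, h4⟩
    have hA : A = 0 := by
      rcases mul_eq_zero.mp (by linarith : A * B = 0) with h | h
      · exact h
      · rw [h] at h3
        nlinarith [sq_nonneg A, sq_pos_of_pos hρ]
    refine ⟨hA, ?_⟩
    rw [hA] at h3
    rw [← abs_of_pos hρ]
    exact (sq_eq_sq_iff_abs_eq_abs B ρ).mp (by linarith)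
  · rintro ⟨rfl, rfl⟩
    rw [sq_abs]
    constructor <;> ring

theorem inner_cs_eq_zero_iff {ħ M L ν β ν' β' : ℝ} (hħ : 0 < ħ) (hM : 0 < M) (hL : 0 < L)
    (hν : 0 ≤ ν) (hβ : 0 ≤ β) (hν' : 0 ≤ ν') (hβ' : 0 ≤ β') (m : ℕ) {q p q' p' : ℝ}
    (hq : q ∈ Ioo (0 : ℝ) L) (hq' : q' ∈ Ioo (0 : ℝ) L) :
    inner ℂ (cs ħ M L ν' β' m q' p') (cs ħ M L ν β m q p) = 0 ↔
      (ν + m + 1) * Real.cot (Real.pi * q / L) + (ν' + m + 1) * Real.cot (Real.pi * q' / L) = 0 ∧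
        ∃ k : ℕ, |p - p'| * L = Real.pi * ħ * (ν + ν' + 2 * m + 4 + 2 * k) := by
  obtain ⟨u, hu, h⟩ := exists_cs_eq hħ hM hL hν hβ m
  obtain ⟨u', hu', h'⟩ := exists_cs_eq hħ hM hL hν' hβ' m
  have hs : 0 ≤ ν + m + 1 := by positivity
  have hs' : 0 ≤ ν' + m + 1 := by positivity
  have hpi := Real.pi_pos
  have hne : ∀ (u : ℂ) (s : ℝ) (w : ℂ), ‖u‖ = 1 → 0 ≤ s →
      u * ((‖packet L s w‖⁻¹ : ℝ) : ℂ) ≠ 0 := by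
    intro u s w hu hs
    refine mul_ne_zero (fun h => by simp [h] at hu) ?_
    exact_mod_cast inv_ne_zero (norm_ne_zero_iff.mpr (packet_ne_zero hL hs w))
  have hLpi : ((L / Real.pi : ℝ) : ℂ) ≠ 0 := by
    exact_mod_cast (by positivity : L / Real.pi ≠ 0)
  rw [(h q hq p).2, (h' q' hq' p').2, inner_smul_left, inner_smul_right, mul_eq_zero, mul_eq_zero,
    or_iff_right ((map_ne_zero _).mpr (hne u' _ _ hu' hs')), or_iff_right (hne u _ _ hu hs),
    inner_packet hL hs hs', mul_eq_zero, or_iff_right hLpi,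
    sinExpInt_eq_zero_iff (by positivity), ← exists_and_left]
  refine exists_congr fun k => ?_
  have hρ : 0 < ν + ν' + 2 * m + 4 + 2 * (k : ℝ) := by positivity
  -- The cotangents give the real part and `p - p'` the imaginary part, so a factor vanishes when
  -- the real part is zero and the imaginary part is, in absolute value, `r + 2 + 2k` with `r = ν +
  -- ν' + 2m + 2`.
  have harg : (star (csExponent ħ L (ν' + m + 1) q' p') + csExponent ħ L (ν + m + 1) q p)
      * (L / Real.pi) = ((-((ν + m + 1) * Real.cot (Real.pi * q / L)
        + (ν' + m + 1) * Real.cot (Real.pi * q' / L)) : ℝ) : ℂ)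
        + Complex.I * (((p - p') * L / (Real.pi * ħ) : ℝ) : ℂ) := by
    have h1 : (L : ℂ) ≠ 0 := by exact_mod_cast hL.ne'
    have h2 : (ħ : ℂ) ≠ 0 := by exact_mod_cast hħ.ne'
    have h3 : (Real.pi : ℂ) ≠ 0 := by exact_mod_cast hpi.ne'
    simp only [csExponent, Complex.star_def, map_add, map_div₀, map_mul, Complex.conj_ofReal,
      Complex.conj_I]
    push_cast
    field_simp
    ring
  rw [harg, show (((ν + m + 1 + (ν' + m + 1) : ℝ) : ℂ) + 2 + 2 * k)
    = ((ν + ν' + 2 * m + 4 + 2 * (k : ℝ) : ℝ) : ℂ) by push_cast; ring,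
    sq_add_sq_eq_zero_iff hρ, neg_eq_zero, abs_div, abs_mul, abs_of_pos hL,
    abs_of_pos (mul_pos hpi hħ), div_eq_iff (by positivity), mul_comm (_ + 2 * (k : ℝ))]

/-! ### The Fourier transform of `cosh^{-2s}` -/

theorem sq_le_sinh_sq (y : ℝ) : y ^ 2 ≤ Real.sinh y ^ 2 := by
  rw [sq_le_sq]
  rcases le_total 0 y with h | h
  · rw [abs_of_nonneg h, abs_of_nonneg (Real.sinh_nonneg_iff.mpr h)]
    exact Real.self_le_sinh_iff.mpr h
  · rw [abs_of_nonpos h, abs_of_nonpos (Real.sinh_nonpos_iff.mpr h)]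
    have := Real.sinh_le_self_iff.mpr h
    linarith

/-- The Fourier integral `∫ exp (iuy) cosh^{-2s} y dy`. -/
def sechInt (s u : ℝ) : ℂ :=
  ∫ y : ℝ, Complex.exp (Complex.I * u * y) * ((Real.cosh y ^ (-(2 * s)) : ℝ) : ℂ)

theorem continuous_cosh_rpow (a : ℝ) : Continuous fun y : ℝ => Real.cosh y ^ a :=
  Real.continuous_cosh.rpow_const fun y => Or.inl (Real.cosh_pos y).ne'

theorem cosh_rpow_le {s : ℝ} (hs : 1 ≤ s) (y : ℝ) :
    Real.cosh y ^ (-(2 * s)) ≤ (1 + y ^ 2)⁻¹ := by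
  have h1 : Real.cosh y ^ (-(2 * s)) ≤ Real.cosh y ^ (-(2 : ℝ)) :=
    Real.rpow_le_rpow_of_exponent_le (Real.one_le_cosh y) (by linarith)
  refine h1.trans ?_
  rw [Real.rpow_neg (Real.cosh_pos y).le, Real.rpow_two]
  have h2 := Real.cosh_sq y
  have h3 := sq_le_sinh_sq y
  exact inv_anti₀ (by positivity) (by linarith)

theorem integrable_cosh_rpow {s : ℝ} (hs : 1 ≤ s) :
    Integrable fun y : ℝ => Real.cosh y ^ (-(2 * s)) := by
  refine integrable_inv_one_add_sq.mono' (continuous_cosh_rpow _).aestronglyMeasurable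
    (Filter.Eventually.of_forall fun y => ?_)
  rw [Real.norm_of_nonneg (Real.rpow_nonneg (Real.cosh_pos y).le _)]
  exact cosh_rpow_le hs y

theorem norm_exp_I_mul_mul (u y : ℝ) : ‖Complex.exp (Complex.I * u * y)‖ = 1 := by
  rw [show Complex.I * u * y = ((u * y : ℝ) : ℂ) * Complex.I by push_cast; ring,
    Complex.norm_exp_ofReal_mul_I]

theorem integrable_sech {s : ℝ} (hs : 1 ≤ s) (u : ℝ) :
    Integrable fun y : ℝ =>
      Complex.exp (Complex.I * u * y) * ((Real.cosh y ^ (-(2 * s)) : ℝ) : ℂ) := by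
  have := continuous_cosh_rpow (-(2 * s))
  refine (integrable_cosh_rpow hs).mono' (by fun_prop) (Filter.Eventually.of_forall fun y => ?_)
  rw [norm_mul, norm_exp_I_mul_mul, one_mul, Complex.norm_real,
    Real.norm_of_nonneg (Real.rpow_nonneg (Real.cosh_pos y).le _)]

/-- With `f = cosh^{-2s}` one has `f'' = 4s² f - 2s(2s+1) cosh^{-2s-2}`. The identity integrates the
derivative of `exp(iuy)(f' - iuf)` over the line. -/
theorem sechInt_add_one {s : ℝ} (hs : 1 ≤ s) (u : ℝ) :
    (u ^ 2 + 4 * s ^ 2) * sechInt s u = 2 * s * (2 * s + 1) * sechInt (s + 1) u := by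
  set e : ℝ → ℂ := fun y => Complex.exp (Complex.I * u * y)
  set f : ℝ → ℝ := fun y => Real.cosh y ^ (-(2 * s))
  set g : ℝ → ℝ := fun y => -(2 * s) * (Real.sinh y * Real.cosh y ^ (-(2 * s) - 1))
  have he : ∀ y, HasDerivAt e (e y * (Complex.I * u)) y := fun y => by
    have := (Complex.ofRealCLM.hasDerivAt (x := y)).const_mul (Complex.I * u)
    simpa using this.cexp
  have hf : ∀ y, HasDerivAt f (g y) y := fun y => by
    refine ((Real.hasDerivAt_cosh y).rpow_const (p := -(2 * s))
      (Or.inl (Real.cosh_pos y).ne')).congr_deriv ?_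
    simp only [g]; ring
  have hfs : ∀ y, Real.cosh y ^ (-(2 * (s + 1))) = f y / Real.cosh y ^ 2 := fun y => by
    rw [← Real.rpow_two, ← Real.rpow_sub (Real.cosh_pos y)]; ring_nf
  have hg : ∀ y, HasDerivAt g (4 * s ^ 2 * f y
      - 2 * s * (2 * s + 1) * Real.cosh y ^ (-(2 * (s + 1)))) y := fun y => by
    have hc := (Real.cosh_pos y).ne'
    have h1 := (Real.hasDerivAt_cosh y).rpow_const (p := -(2 * s) - 1) (Or.inl hc)
    refine (((Real.hasDerivAt_sinh y).mul h1).const_mul (-(2 * s))).congr_deriv ?_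
    rw [hfs]
    simp only [Real.rpow_sub_one hc]
    have := Real.cosh_sq y
    change _ = 4 * s ^ 2 * f y - 2 * s * (2 * s + 1) * (f y / Real.cosh y ^ 2)
    rw [show Real.cosh y ^ (-(2 * s)) = f y from rfl]
    field_simp
    linear_combination (-2 * f y * (2 * s + 1)) * this
  have hint : Integrable fun y => ((u ^ 2 + 4 * s ^ 2 : ℝ) : ℂ) * (e y * (f y : ℂ))
      - ((2 * s * (2 * s + 1) : ℝ) : ℂ) * (e y * ((Real.cosh y ^ (-(2 * (s + 1))) : ℝ) : ℂ)) :=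
    ((integrable_sech hs u).const_mul _).sub ((integrable_sech (by linarith) u).const_mul _)
  have hint0 : Integrable fun y => e y * ((g y : ℂ) - Complex.I * u * (f y : ℂ)) := by
    have hfc : Continuous f := continuous_cosh_rpow _
    have hgc : Continuous g := by
      have := continuous_cosh_rpow (-(2 * s) - 1)
      fun_prop
    refine ((integrable_cosh_rpow hs).const_mul (2 * s + |u|)).mono'
      (by fun_prop) (Filter.Eventually.of_forall fun y => ?_)
    have hf0 : 0 ≤ f y := Real.rpow_nonneg (Real.cosh_pos y).le _
    have hgf : |g y| ≤ 2 * s * f y := by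
      simp only [g]
      rw [Real.rpow_sub_one (Real.cosh_pos y).ne', abs_mul, abs_neg,
        abs_of_nonneg (by positivity : 0 ≤ 2 * s)]
      gcongr
      rw [mul_div_left_comm, abs_mul, abs_of_nonneg (by exact hf0)]
      refine mul_le_of_le_one_right hf0 ?_
      rw [abs_div, abs_of_pos (Real.cosh_pos y), div_le_one (Real.cosh_pos y)]
      exact abs_le_of_sq_le_sq (by rw [Real.cosh_sq]; linarith) (Real.cosh_pos y).le
    rw [norm_mul, norm_exp_I_mul_mul, one_mul]
    refine (norm_sub_le _ _).trans ?_
    rw [norm_mul, norm_mul, Complex.norm_I, Complex.norm_real, Complex.norm_real,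
      Complex.norm_real, Real.norm_of_nonneg hf0, Real.norm_eq_abs, Real.norm_eq_abs, add_mul]
    linarith
  have h0 := integral_eq_zero_of_hasDerivAt_of_integrable (fun y => by
    refine ((he y).mul (((hg y).ofReal_comp).sub
      ((hf y).ofReal_comp.const_mul (Complex.I * u)))).congr_deriv
      (g' := ((u ^ 2 + 4 * s ^ 2 : ℝ) : ℂ) * (e y * (f y : ℂ)) - ((2 * s * (2 * s + 1) : ℝ) : ℂ)
        * (e y * ((Real.cosh y ^ (-(2 * (s + 1))) : ℝ) : ℂ))) ?_
    simp only [Pi.sub_apply]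
    push_cast
    linear_combination (-(e y * u ^ 2 * (f y : ℂ))) * Complex.I_sq) hint hint0
  rw [integral_sub ((integrable_sech hs u).const_mul _)
    ((integrable_sech (by linarith) u).const_mul _), integral_const_mul, integral_const_mul] at h0
  have := sub_eq_zero.mp h0
  push_cast at this
  exact this

/-- The real value of `sechInt` at `u = 0`. -/
theorem sechInt_zero (s : ℝ) :
    sechInt s 0 = ((∫ y : ℝ, Real.cosh y ^ (-(2 * s)) : ℝ) : ℂ) := by
  rw [sechInt, ← integral_complex_ofReal]
  simp

theorem integral_cosh_rpow_pos {s : ℝ} (hs : 1 ≤ s) :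
    0 < ∫ y : ℝ, Real.cosh y ^ (-(2 * s)) := by
  have h : ∀ y : ℝ, 0 < Real.cosh y ^ (-(2 * s)) := fun y =>
    Real.rpow_pos_of_pos (Real.cosh_pos y) _
  rw [integral_pos_iff_support_of_nonneg (fun y => (h y).le) (integrable_cosh_rpow hs),
    show Function.support (fun y : ℝ => Real.cosh y ^ (-(2 * s))) = univ from
      eq_univ_of_forall fun y => (h y).ne']
  simp

/-- Quantitative concentration of `cosh^{-2s-2}` at `0`. Bound `|exp(iuy) - 1|` by `|uy| ≤ u²/(2a) +
(a/2) sinh² y`; the second moment `∫ sinh² y cosh^{-2s-2} y dy` is `J s - J (s+1)`, which the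
recurrence at `u = 0` evaluates. -/
theorem norm_sechInt_sub_le {s : ℝ} (hs : 1 ≤ s) (u : ℝ) :
    ‖sechInt (s + 1) u - sechInt (s + 1) 0‖
      ≤ (u ^ 2 + 1) / (2 * Real.sqrt (2 * s)) * ‖sechInt (s + 1) 0‖ := by
  have hs1 : 1 ≤ s + 1 := by linarith
  set J : ℝ → ℝ := fun s => ∫ y : ℝ, Real.cosh y ^ (-(2 * s)) with hJ
  have hrec : 2 * s * J s = (2 * s + 1) * J (s + 1) := by
    have h := sechInt_add_one hs 0
    rw [sechInt_zero, sechInt_zero] at h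
    have h1 : (0 ^ 2 + 4 * s ^ 2) * J s = 2 * s * (2 * s + 1) * J (s + 1) := by exact_mod_cast h
    have h2 : 2 * s * (2 * s * J s) = 2 * s * ((2 * s + 1) * J (s + 1)) := by linarith
    exact mul_left_cancel₀ (by positivity) h2
  -- Since `J s - J (s+1) = J (s+1)/(2s)`, this weight makes both terms of order `s^{-1/2}`.
  set a := Real.sqrt (2 * s) with ha
  have ha0 : 0 < a := Real.sqrt_pos.mpr (by linarith)
  have ha2 : a ^ 2 = 2 * s := Real.sq_sqrt (by linarith)
  have hsub : Integrable fun y : ℝ => Real.cosh y ^ (-(2 * s)) - Real.cosh y ^ (-(2 * (s + 1))) :=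
    (integrable_cosh_rpow hs).sub (integrable_cosh_rpow hs1)
  have hdom : Integrable fun y : ℝ => (u ^ 2 / (2 * a)) * Real.cosh y ^ (-(2 * (s + 1)))
      + a / 2 * (Real.cosh y ^ (-(2 * s)) - Real.cosh y ^ (-(2 * (s + 1)))) :=
    ((integrable_cosh_rpow hs1).const_mul _).add (hsub.const_mul _)
  have hbound : ‖sechInt (s + 1) u - sechInt (s + 1) 0‖ ≤
      u ^ 2 / (2 * a) * J (s + 1) + a / 2 * (J s - J (s + 1)) := by
    rw [sechInt, sechInt, ← integral_sub (integrable_sech hs1 u) (integrable_sech hs1 0)]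
    refine (norm_integral_le_of_norm_le hdom (Filter.Eventually.of_forall fun y => ?_)).trans_eq ?_
    · have hpos : 0 < Real.cosh y ^ (-(2 * (s + 1))) := Real.rpow_pos_of_pos (Real.cosh_pos y) _
      have hfs : Real.cosh y ^ (-(2 * s)) = Real.cosh y ^ (-(2 * (s + 1))) * Real.cosh y ^ 2 := by
        rw [← Real.rpow_two, ← Real.rpow_add (Real.cosh_pos y)]; ring_nf
      rw [hfs, ← sub_mul, norm_mul, Complex.norm_real, Real.norm_of_nonneg hpos.le, Real.cosh_sq]
      have h1 : ‖Complex.exp (Complex.I * u * y) - Complex.exp (Complex.I * (0 : ℝ) * y)‖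
          ≤ |u * y| := by
        have := Real.norm_exp_I_mul_ofReal_sub_one_le (x := u * y)
        rw [Real.norm_eq_abs] at this
        convert this using 3
        · push_cast; ring_nf
        · simp
      have h2 : |u * y| ≤ u ^ 2 / (2 * a) + a / 2 * Real.sinh y ^ 2 := by
        have h3 := sq_le_sinh_sq y
        have h4 : |u * y| ≤ u ^ 2 / (2 * a) + a / 2 * y ^ 2 := by
          have h5 : u ^ 2 / (2 * a) + a / 2 * y ^ 2 - |u| * |y|
              = (|u| - a * |y|) ^ 2 / (2 * a) := by
            rw [← sq_abs u, ← sq_abs y]; field_simp; ring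
          rw [abs_mul]
          have : 0 ≤ (|u| - a * |y|) ^ 2 / (2 * a) := by positivity
          linarith
        have : a / 2 * y ^ 2 ≤ a / 2 * Real.sinh y ^ 2 := by gcongr
        linarith
      have := mul_le_mul_of_nonneg_right (h1.trans h2) hpos.le
      linarith
    · rw [integral_add ((integrable_cosh_rpow hs1).const_mul _) (hsub.const_mul _),
        integral_const_mul, integral_const_mul, integral_sub (integrable_cosh_rpow hs)
        (integrable_cosh_rpow hs1)]
  refine hbound.trans_eq ?_
  rw [sechInt_zero, Complex.norm_real, Real.norm_of_nonneg (integral_cosh_rpow_pos hs1).le]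
  change _ = _ * J (s + 1)
  have h6 : J s - J (s + 1) = J (s + 1) / a ^ 2 := by
    rw [ha2, eq_div_iff (by positivity)]; linarith
  rw [h6]
  field_simp

theorem tendsto_sechInt_div {s : ℝ} (hs : 1 ≤ s) (u : ℝ) :
    Filter.Tendsto (fun n : ℕ => sechInt (s + n) u / sechInt (s + n) 0) Filter.atTop (nhds 1) := by
  rw [← Filter.tendsto_add_atTop_iff_nat 1, tendsto_iff_norm_sub_tendsto_zero]
  have hlim : Filter.Tendsto (fun n : ℕ => (u ^ 2 + 1) / (2 * Real.sqrt (2 * (s + n))))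
      Filter.atTop (nhds 0) := by
    refine Filter.Tendsto.const_div_atTop ?_ _
    refine Filter.Tendsto.const_mul_atTop two_pos (Real.tendsto_sqrt_atTop.comp ?_)
    exact Filter.Tendsto.const_mul_atTop two_pos
      (Filter.tendsto_atTop_add_const_left _ _ tendsto_natCast_atTop_atTop)
  refine squeeze_zero (fun _ => norm_nonneg _) (fun n => ?_) hlim
  have hsn : 1 ≤ s + n := le_add_of_le_of_nonneg hs (Nat.cast_nonneg n)
  have h0 : sechInt (s + n + 1) 0 ≠ 0 := by
    rw [sechInt_zero]
    exact_mod_cast (integral_cosh_rpow_pos (by linarith : 1 ≤ s + n + 1)).ne'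
  have h := norm_sechInt_sub_le hsn u
  rw [show s + ((n + 1 : ℕ) : ℝ) = s + n + 1 by push_cast; ring, div_sub_one h0, norm_div,
    div_le_iff₀ (norm_pos_iff.mpr h0)]
  exact h

/-! ### Reciprocity of the two integrals and growth bounds -/

/-- The real integral `∫_0^π sin^r t exp (u t) dt`. -/
def sinExpIntReal (r u : ℝ) : ℝ := ∫ t in (0 : ℝ)..Real.pi, Real.sin t ^ r * Real.exp (u * t)

theorem sinExpInt_ofReal (r u : ℝ) : sinExpInt r u = sinExpIntReal r u := by
  rw [sinExpInt, sinExpIntReal, ← intervalIntegral.integral_ofReal]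
  push_cast
  rfl

theorem continuous_sinExpReal {r : ℝ} (hr : 0 ≤ r) (u : ℝ) :
    Continuous fun t : ℝ => Real.sin t ^ r * Real.exp (u * t) := by
  have h1 : Continuous fun x : ℝ => Real.sin x ^ r :=
    Continuous.rpow_const (by fun_prop) fun _ => Or.inr hr
  fun_prop

theorem sinExpIntReal_pos {r : ℝ} (hr : 0 ≤ r) (u : ℝ) : 0 < sinExpIntReal r u := by
  refine intervalIntegral.intervalIntegral_pos_of_pos_on
    ((continuous_sinExpReal hr u).intervalIntegrable _ _) (fun t ht => ?_) Real.pi_pos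
  have := Real.sin_pos_of_pos_of_lt_pi ht.1 ht.2
  positivity

theorem sinExpIntReal_add_two {r : ℝ} (hr : 0 ≤ r) (u : ℝ) :
    (u ^ 2 + (r + 2) ^ 2) * sinExpIntReal (r + 2) u = (r + 2) * (r + 1) * sinExpIntReal r u := by
  have h := sinExpInt_add_two hr u
  rw [sinExpInt_ofReal, sinExpInt_ofReal] at h
  exact_mod_cast h

/-- `sechInt` and `sinExpInt` are reciprocal to each other, up to elementary factors. -/
theorem sechInt_mul_sinExpInt {s : ℝ} (hs : 1 ≤ s) (u : ℝ) :
    sechInt s u * sinExpInt (2 * s - 2) u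
      = sechInt s 0 * sinExpInt (2 * s - 2) 0 * Complex.exp (u * (Real.pi / 2)) := by
  have hS0 : ∀ n : ℕ, sechInt (s + n) 0 ≠ 0 := fun n => by
    rw [sechInt_zero]
    exact_mod_cast (integral_cosh_rpow_pos (le_add_of_le_of_nonneg hs (Nat.cast_nonneg n))).ne'
  have hF : ∀ (n : ℕ) (u : ℝ), sinExpInt (2 * s - 2 + 2 * n) u ≠ 0 := fun n u => by
    rw [sinExpInt_ofReal]
    exact_mod_cast (sinExpIntReal_pos (add_nonneg (by linarith) (by positivity)) u).ne'
  -- The factor `u² + 4(s+n)²` enters the two recurrences inversely, so the product changes by a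
  -- factor independent of `u`.
  have hstep : ∀ (n : ℕ) (u : ℝ),
      (2 * (s + n) + 1) * (sechInt (s + (n + 1 : ℕ)) u * sinExpInt (2 * s - 2 + 2 * (n + 1 : ℕ)) u)
        = (2 * (s + n) - 1) * (sechInt (s + n) u * sinExpInt (2 * s - 2 + 2 * n) u) := by
    intro n u
    have hsn : 1 ≤ s + n := le_add_of_le_of_nonneg hs (Nat.cast_nonneg n)
    have h1 := sechInt_add_one hsn u
    have h2 := sinExpInt_add_two (r := 2 * s - 2 + 2 * n) (add_nonneg (by linarith)
      (by positivity)) u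
    rw [show 2 * s - 2 + 2 * (n : ℝ) + 2 = 2 * s - 2 + 2 * (n + 1 : ℕ) by push_cast; ring] at h2
    rw [show s + (n : ℝ) + 1 = s + (n + 1 : ℕ) by push_cast; ring] at h1
    have h3 : ((u ^ 2 + 4 * (s + n) ^ 2 : ℝ) : ℂ) ≠ 0 := by
      have : u ^ 2 + 4 * (s + n) ^ 2 ≠ 0 := by positivity
      exact_mod_cast this
    have h4 : ((2 * (s + n) : ℝ) : ℂ) ≠ 0 := by
      have : 2 * (s + n) ≠ 0 := by positivity
      exact_mod_cast this
    refine mul_left_cancel₀ (mul_ne_zero h3 h4) ?_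
    push_cast at h1 h2 ⊢
    linear_combination (-(u ^ 2 + 4 * (s + n : ℂ) ^ 2) * sinExpInt (2 * s - 2 + 2 * (n + 1)) u) * h1
      + (u ^ 2 + 4 * (s + n : ℂ) ^ 2) * sechInt (s + n) u * h2
  -- Normalized at `u = 0`, the product does not depend on `n`; its limit is `1 · exp(uπ/2)`.
  have hinv : ∀ n : ℕ, sechInt (s + n) u / sechInt (s + n) 0
      * (sinExpInt (2 * s - 2 + 2 * n) u / sinExpInt (2 * s - 2 + 2 * n) (0 : ℝ))
      = sechInt s u / sechInt s 0 * (sinExpInt (2 * s - 2) u / sinExpInt (2 * s - 2) (0 : ℝ)) := by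
    intro n
    induction n with
    | zero => simp
    | succ n ih =>
      rw [← ih, div_mul_div_comm, div_mul_div_comm, div_eq_div_iff
        (mul_ne_zero (hS0 _) (hF _ _)) (mul_ne_zero (hS0 _) (hF _ _))]
      have h1 : ((2 * (s + n) + 1 : ℝ) : ℂ) ≠ 0 := by
        have : 2 * (s + n) + 1 ≠ 0 := by positivity
        exact_mod_cast this
      refine mul_left_cancel₀ h1 ?_
      have e1 := hstep n u
      have e2 := hstep n 0
      rw [← mul_assoc]
      push_cast at e1 e2 ⊢
      rw [e1]
      linear_combination (-(sechInt (s + n) u * sinExpInt (2 * s - 2 + 2 * n) u)) * e2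
  have hlim := (tendsto_sechInt_div hs u).mul
    (tendsto_sinExpInt_div (r := 2 * s - 2) (by linarith) u)
  have heq := tendsto_nhds_unique tendsto_const_nhds (hlim.congr fun n => by
    simpa using hinv n)
  have h0 : sechInt s 0 ≠ 0 := by simpa using hS0 0
  have h1 : sinExpInt (2 * s - 2) 0 ≠ 0 := by simpa using hF 0 0
  rw [one_mul, div_mul_div_comm, div_eq_iff (mul_ne_zero h0 h1)] at heq
  rw [heq]
  ring

theorem continuous_sinExpIntReal {r : ℝ} (hr : 0 ≤ r) : Continuous (sinExpIntReal r) := by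
  refine intervalIntegral.continuous_parametric_intervalIntegral_of_continuous' ?_ _ _
  have h1 : Continuous fun x : ℝ => Real.sin x ^ r :=
    Continuous.rpow_const (by fun_prop) fun _ => Or.inr hr
  have h2 : Continuous fun z : ℝ × ℝ => Real.sin z.2 ^ r := h1.comp continuous_snd
  exact h2.mul (by fun_prop)

/-- Keep only `[b,π]` when `u ≥ 0` and only `[0,b]` when `u ≤ 0`: there `exp(ut) ≥ exp(ub)`. -/
theorem exists_exp_le_sinExpIntReal {r : ℝ} (hr : 0 ≤ r) {b : ℝ} (hb : b ∈ Ioo 0 Real.pi) :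
    ∃ c > 0, ∀ u, c * Real.exp (u * b) ≤ sinExpIntReal r u := by
  have hc : Continuous fun x : ℝ => Real.sin x ^ r :=
    Continuous.rpow_const (by fun_prop) fun _ => Or.inr hr
  have h1 : 0 < ∫ t in (0 : ℝ)..b, Real.sin t ^ r :=
    intervalIntegral.intervalIntegral_pos_of_pos_on (hc.intervalIntegrable _ _) (fun t ht =>
      Real.rpow_pos_of_pos (Real.sin_pos_of_pos_of_lt_pi ht.1 (ht.2.trans hb.2)) _) hb.1
  have h2 : 0 < ∫ t in b..Real.pi, Real.sin t ^ r :=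
    intervalIntegral.intervalIntegral_pos_of_pos_on (hc.intervalIntegrable _ _) (fun t ht =>
      Real.rpow_pos_of_pos (Real.sin_pos_of_pos_of_lt_pi (hb.1.trans ht.1) ht.2) _) hb.2
  refine ⟨min _ _, lt_min h1 h2, fun u => ?_⟩
  have hcu := continuous_sinExpReal hr u
  have hsplit : sinExpIntReal r u = (∫ t in (0 : ℝ)..b, Real.sin t ^ r * Real.exp (u * t))
      + ∫ t in b..Real.pi, Real.sin t ^ r * Real.exp (u * t) :=
    (intervalIntegral.integral_add_adjacent_intervals (hcu.intervalIntegrable _ _)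
      (hcu.intervalIntegrable _ _)).symm
  have hnn1 : ∀ t ∈ Icc 0 b, 0 ≤ Real.sin t ^ r := fun t ht =>
    Real.rpow_nonneg (Real.sin_nonneg_of_nonneg_of_le_pi ht.1 (ht.2.trans hb.2.le)) _
  have hnn2 : ∀ t ∈ Icc b Real.pi, 0 ≤ Real.sin t ^ r := fun t ht =>
    Real.rpow_nonneg (Real.sin_nonneg_of_nonneg_of_le_pi (hb.1.le.trans ht.1) ht.2) _
  have hp1 : 0 ≤ ∫ t in (0 : ℝ)..b, Real.sin t ^ r * Real.exp (u * t) :=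
    intervalIntegral.integral_nonneg hb.1.le fun t ht =>
      mul_nonneg (hnn1 t ht) (Real.exp_pos _).le
  have hp2 : 0 ≤ ∫ t in b..Real.pi, Real.sin t ^ r * Real.exp (u * t) :=
    intervalIntegral.integral_nonneg hb.2.le fun t ht =>
      mul_nonneg (hnn2 t ht) (Real.exp_pos _).le
  rw [hsplit]
  rcases le_total 0 u with hu | hu
  · have : (∫ t in b..Real.pi, Real.sin t ^ r) * Real.exp (u * b)
        ≤ ∫ t in b..Real.pi, Real.sin t ^ r * Real.exp (u * t) := by
      rw [← intervalIntegral.integral_mul_const]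
      refine intervalIntegral.integral_mono_on hb.2.le ((hc.mul_const _).intervalIntegrable _ _)
        (hcu.intervalIntegrable _ _) fun t ht => ?_
      exact mul_le_mul_of_nonneg_left (Real.exp_le_exp.mpr
        (mul_le_mul_of_nonneg_left ht.1 hu)) (hnn2 t ht)
    have h3 := mul_le_mul_of_nonneg_right (min_le_right (∫ t in (0 : ℝ)..b, Real.sin t ^ r)
      (∫ t in b..Real.pi, Real.sin t ^ r)) (Real.exp_pos (u * b)).le
    linarith
  · have : (∫ t in (0 : ℝ)..b, Real.sin t ^ r) * Real.exp (u * b)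
        ≤ ∫ t in (0 : ℝ)..b, Real.sin t ^ r * Real.exp (u * t) := by
      rw [← intervalIntegral.integral_mul_const]
      refine intervalIntegral.integral_mono_on hb.1.le ((hc.mul_const _).intervalIntegrable _ _)
        (hcu.intervalIntegrable _ _) fun t ht => ?_
      exact mul_le_mul_of_nonneg_left (Real.exp_le_exp.mpr
        (mul_le_mul_of_nonpos_left ht.2 hu)) (hnn1 t ht)
    have h3 := mul_le_mul_of_nonneg_right (min_le_left (∫ t in (0 : ℝ)..b, Real.sin t ^ r)
      (∫ t in b..Real.pi, Real.sin t ^ r)) (Real.exp_pos (u * b)).le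
    linarith

theorem integrable_exp_div_sinExpIntReal {r : ℝ} (hr : 0 ≤ r) {ξ : ℝ} (hξ : ξ ∈ Ioo 0 Real.pi) :
    Integrable fun u : ℝ => Real.exp (u * ξ) / sinExpIntReal r u := by
  have hmeas : Continuous fun u : ℝ => Real.exp (u * ξ) / sinExpIntReal r u :=
    Continuous.div (by fun_prop) (continuous_sinExpIntReal hr) fun u => (sinExpIntReal_pos hr u).ne'
  have hbound : ∀ b ∈ Ioo 0 Real.pi, ∃ C, ∀ u,
      ‖Real.exp (u * ξ) / sinExpIntReal r u‖ ≤ C * Real.exp ((ξ - b) * u) := by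
    intro b hb
    obtain ⟨c, hc, h⟩ := exists_exp_le_sinExpIntReal hr hb
    refine ⟨c⁻¹, fun u => ?_⟩
    rw [Real.norm_of_nonneg (div_nonneg (Real.exp_pos _).le (sinExpIntReal_pos hr u).le),
      div_le_iff₀ (sinExpIntReal_pos hr u)]
    calc Real.exp (u * ξ) = c⁻¹ * Real.exp ((ξ - b) * u) * (c * Real.exp (u * b)) := by
          rw [show u * ξ = (ξ - b) * u + u * b by ring, Real.exp_add]
          field_simp
      _ ≤ _ := by gcongr; exact h u
  -- Decay at `-∞` requires `b < ξ` and decay at `+∞` requires `b > ξ`; the midpoints towards `0`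
  -- and `π` serve.
  rw [← integrableOn_univ, ← Iic_union_Ioi (a := (0 : ℝ))]
  refine IntegrableOn.union ?_ ?_
  · obtain ⟨C, hC⟩ := hbound (ξ / 2) ⟨by linarith [hξ.1], by linarith [hξ.1, hξ.2]⟩
    exact Integrable.mono' ((integrableOn_exp_mul_Iic (by linarith [hξ.1]) 0).const_mul C)
      hmeas.aestronglyMeasurable (Filter.Eventually.of_forall hC)
  · obtain ⟨C, hC⟩ := hbound ((ξ + Real.pi) / 2) ⟨by linarith [hξ.1, hξ.2], by linarith [hξ.2]⟩
    exact Integrable.mono' ((integrableOn_exp_mul_Ioi (by linarith [hξ.2]) 0).const_mul C)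
      hmeas.aestronglyMeasurable (Filter.Eventually.of_forall hC)

theorem pi_div_two_mem : Real.pi / 2 ∈ Ioo 0 Real.pi :=
  ⟨by have := Real.pi_pos; positivity, by linarith [Real.pi_pos]⟩

/-! ### Fourier inversion and the Laplace transform of the reciprocal -/

/-- Fourier inversion for `sechInt`. -/
theorem integral_exp_mul_sechInt {s : ℝ} (hs : 1 ≤ s) (y : ℝ) :
    ∫ u : ℝ, Complex.exp (Complex.I * u * y) * sechInt s u
      = 2 * Real.pi * ((Real.cosh y ^ (-(2 * s)) : ℝ) : ℂ) := by
  have hr : 0 ≤ 2 * s - 2 := by linarith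
  set f : ℝ → ℂ := fun y => ((Real.cosh y ^ (-(2 * s)) : ℝ) : ℂ) with hf
  have hfc : Continuous f := Complex.continuous_ofReal.comp (continuous_cosh_rpow _)
  have hfi : Integrable f := (integrable_cosh_rpow hs).ofReal
  have hpi := Real.pi_pos
  have hF : ∀ w : ℝ, FourierTransform.fourier f w = sechInt s (-(2 * Real.pi) * w) := by
    intro w
    rw [Real.fourier_real_eq_integral_exp_smul, sechInt]
    refine integral_congr_ae (Filter.Eventually.of_forall fun v => ?_)
    simp only [smul_eq_mul, hf]
    congr 2
    push_cast
    ring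
  -- Inversion needs an integrable transform; reciprocity turns this into the bound on
  -- `exp(uπ/2)/F_{2s-2}(u)`.
  have hsi : Integrable fun u => sechInt s u := by
    have h : ∀ u : ℝ, sechInt s u = sechInt s 0 * sinExpInt (2 * s - 2) 0
        * ((Real.exp (u * (Real.pi / 2)) / sinExpIntReal (2 * s - 2) u : ℝ) : ℂ) := by
      intro u
      have h0 : (sinExpIntReal (2 * s - 2) u : ℂ) ≠ 0 := by
        exact_mod_cast (sinExpIntReal_pos hr u).ne'
      have := sechInt_mul_sinExpInt hs u
      rw [sinExpInt_ofReal] at this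
      rw [eq_comm, Complex.ofReal_div, mul_div_assoc', div_eq_iff h0, this]
      push_cast
      ring
    rw [show (fun u => sechInt s u) = _ from funext h]
    exact (integrable_exp_div_sinExpIntReal hr pi_div_two_mem).ofReal.const_mul _
  have hFi : Integrable (FourierTransform.fourier f) := by
    rw [show FourierTransform.fourier f = _ from funext hF]
    exact hsi.comp_mul_left' (by linarith)
  -- Inversion at `-y` matches the sign in `u = -2πv`; `f` is even.
  have hinv := congrFun (hfc.fourierInv_fourier_eq hfi hFi) (-y)
  rw [Real.fourierInv_eq'] at hinv
  have hcomp := Measure.integral_comp_mul_left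
    (fun u : ℝ => Complex.exp (Complex.I * u * y) * sechInt s u) (-(2 * Real.pi))
  have e1 : ∫ v : ℝ, Complex.exp ((↑(2 * Real.pi * inner ℝ v (-y)) * Complex.I))
      • FourierTransform.fourier f v = ∫ v : ℝ, (fun u : ℝ => Complex.exp (Complex.I * u * y)
        * sechInt s u) (-(2 * Real.pi) * v) := by
    refine integral_congr_ae (Filter.Eventually.of_forall fun v => ?_)
    simp only [smul_eq_mul, hF]
    congr 2
    simp
    ring
  rw [e1, hcomp, inv_neg, abs_neg, abs_of_pos (by positivity), Complex.real_smul] at hinv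
  have h2 : (2 * Real.pi : ℂ) ≠ 0 := by exact_mod_cast (by positivity : 2 * Real.pi ≠ 0)
  have h3 : f (-y) = f y := by simp [hf]
  rw [h3] at hinv
  rw [← show f y = ((Real.cosh y ^ (-(2 * s)) : ℝ) : ℂ) from rfl, ← hinv,
    ← mul_assoc, Complex.ofReal_inv]
  push_cast
  rw [mul_inv_cancel₀ h2, one_mul]

/-- The measure on `ℝ` with density `1 / ∫_0^π sin^r t exp (u t) dt`. -/
def recipMeasure (r : ℝ) : Measure ℝ :=
  volume.withDensity fun u => ENNReal.ofReal (sinExpIntReal r u)⁻¹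

theorem measurable_recip {r : ℝ} (hr : 0 ≤ r) :
    Measurable fun u => ENNReal.ofReal (sinExpIntReal r u)⁻¹ :=
  (continuous_sinExpIntReal hr).measurable.inv.ennreal_ofReal

theorem complexMGF_recipMeasure {r : ℝ} (hr : 0 ≤ r) (z : ℂ) :
    ProbabilityTheory.complexMGF id (recipMeasure r) z
      = ∫ u : ℝ, Complex.exp (z * u) / sinExpIntReal r u := by
  rw [ProbabilityTheory.complexMGF, recipMeasure, integral_withDensity_eq_integral_toReal_smul
    (measurable_recip hr) (by simp)]
  refine integral_congr_ae (Filter.Eventually.of_forall fun u => ?_)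
  simp only
  rw [ENNReal.toReal_ofReal (inv_nonneg.mpr (sinExpIntReal_pos hr u).le), Complex.real_smul, id]
  push_cast
  ring

theorem mem_interior_integrableExpSet {r : ℝ} (hr : 0 ≤ r) {ξ : ℝ} (hξ : ξ ∈ Ioo 0 Real.pi) :
    ξ ∈ interior (ProbabilityTheory.integrableExpSet id (recipMeasure r)) := by
  refine mem_interior.mpr ⟨Ioo 0 Real.pi, fun ξ hξ => ?_, isOpen_Ioo, hξ⟩
  rw [ProbabilityTheory.integrableExpSet, mem_ofPred_eq, recipMeasure,
    integrable_withDensity_iff_integrable_smul' (measurable_recip hr) (by simp)]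
  refine (integrable_exp_div_sinExpIntReal hr hξ).congr (Filter.Eventually.of_forall fun u => ?_)
  simp only
  rw [ENNReal.toReal_ofReal (inv_nonneg.mpr (sinExpIntReal_pos hr u).le), smul_eq_mul, id,
    mul_comm ξ, div_eq_inv_mul]

/-- The Laplace transform of `1 / ∫_0^π sin^{2s-2} t exp (u t) dt` on its strip of convergence. -/
theorem exists_integral_exp_div_eq {s : ℝ} (hs : 1 ≤ s) :
    ∃ κ : ℝ, ∀ ξ ∈ Ioo 0 Real.pi,
      ∫ u : ℝ, Real.exp (u * ξ) / sinExpIntReal (2 * s - 2) u = κ * Real.sin ξ ^ (-(2 * s)) := by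
  have hr : 0 ≤ 2 * s - 2 := by linarith
  set r := 2 * s - 2 with hrdef
  set c : ℝ := (∫ y : ℝ, Real.cosh y ^ (-(2 * s))) * sinExpIntReal r 0 with hc
  have hc0 : 0 < c := mul_pos (integral_cosh_rpow_pos hs) (sinExpIntReal_pos hr 0)
  have hcC : (c : ℂ) ≠ 0 := by exact_mod_cast hc0.ne'
  set κ := 2 * Real.pi / c
  set U : Set ℂ := {z | z.re ∈ Ioo 0 Real.pi} with hU
  set g : ℂ → ℂ := fun z => κ * Complex.sin z ^ (-(2 * s) : ℂ)
  -- Viewed as a moment generating function, the Laplace transform is analytic above the interior of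
  -- its interval of convergence.
  have hf_an : AnalyticOnNhd ℂ (ProbabilityTheory.complexMGF id (recipMeasure r)) U := fun z hz =>
    ProbabilityTheory.analyticAt_complexMGF (mem_interior_integrableExpSet hr hz)
  have hUo : IsOpen U := isOpen_Ioo.preimage Complex.continuous_re
  have hg_an : AnalyticOnNhd ℂ g U := by
    refine DifferentiableOn.analyticOnNhd (fun z hz => ?_) hUo
    refine ((Complex.differentiableAt_sin.cpow_const (Or.inl ?_)).const_mul _).differentiableWithinAt
    -- The real part of `sin z` is `sin(Re z) cosh(Im z) > 0`, so the principal power is holomorphic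
    -- on the strip.
    rw [Complex.sin_eq, ← Complex.ofReal_sin, ← Complex.ofReal_cosh, ← Complex.ofReal_cos,
      ← Complex.ofReal_sinh, ← Complex.ofReal_mul, ← Complex.ofReal_mul, Complex.add_re,
      Complex.ofReal_re, Complex.re_ofReal_mul, Complex.I_re, mul_zero, add_zero]
    exact mul_pos (Real.sin_pos_of_pos_of_lt_pi hz.1 hz.2) (Real.cosh_pos _)
  have hUc : IsPreconnected U := by
    have : Convex ℝ U := (convex_Ioo 0 Real.pi).linear_preimage Complex.reLm
    exact this.isPreconnected
  have hline : ∀ y : ℝ, ProbabilityTheory.complexMGF id (recipMeasure r) (Real.pi / 2 + y * Complex.I)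
      = g (Real.pi / 2 + y * Complex.I) := by
    intro y
    have h1 := integral_exp_mul_sechInt hs y
    have h2 : ∀ u : ℝ, Complex.exp (Complex.I * u * y) * sechInt s u
        = c * (Complex.exp ((Real.pi / 2 + y * Complex.I) * u) / sinExpIntReal r u) := by
      intro u
      have h0 : (sinExpIntReal r u : ℂ) ≠ 0 := by exact_mod_cast (sinExpIntReal_pos hr u).ne'
      have h3 := sechInt_mul_sinExpInt hs u
      rw [sinExpInt_ofReal, sechInt_zero, show (0 : ℂ) = ((0 : ℝ) : ℂ) by simp,
        sinExpInt_ofReal, ← Complex.ofReal_mul] at h3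
      rw [mul_div_assoc', eq_div_iff h0, mul_assoc, h3, ← hc, add_mul, Complex.exp_add,
        show Complex.I * u * y = y * Complex.I * u by ring,
        show (u : ℂ) * (Real.pi / 2) = Real.pi / 2 * u by ring]
      ring
    simp only [h2] at h1
    rw [integral_const_mul] at h1
    rw [complexMGF_recipMeasure hr]
    have h4 : Complex.sin (Real.pi / 2 + y * Complex.I) = ((Real.cosh y : ℝ) : ℂ) := by
      rw [Complex.sin_add, Complex.sin_pi_div_two, Complex.cos_pi_div_two, Complex.cos_mul_I,
        Complex.ofReal_cosh]
      ring
    simp only [g, κ]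
    rw [h4, show (-(2 * s) : ℂ) = ((-(2 * s) : ℝ) : ℂ) by push_cast; ring,
      ← Complex.ofReal_cpow (Real.cosh_pos y).le]
    push_cast at h1 ⊢
    rw [div_mul_eq_mul_div, eq_div_iff hcC, ← h1]
    ring
  have hmem : (Real.pi / 2 : ℂ) ∈ U := by
    have := pi_div_two_mem
    simpa [hU] using this
  -- Agreement on the vertical line accumulates at `π/2`, which is what the identity theorem
  -- requires.
  have hfreq : ∃ᶠ z in nhdsWithin (Real.pi / 2 : ℂ) {(Real.pi / 2 : ℂ)}ᶜ,
      ProbabilityTheory.complexMGF id (recipMeasure r) z = g z := by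
    have ht : Filter.Tendsto (fun y : ℝ => (Real.pi / 2 : ℂ) + y * Complex.I)
        (nhdsWithin 0 {0}ᶜ) (nhdsWithin (Real.pi / 2 : ℂ) {(Real.pi / 2 : ℂ)}ᶜ) := by
      refine tendsto_nhdsWithin_of_tendsto_nhds_of_eventually_within _ ?_ ?_
      · have : Continuous fun y : ℝ => (Real.pi / 2 : ℂ) + y * Complex.I := by fun_prop
        simpa using (this.tendsto 0).mono_left nhdsWithin_le_nhds
      · filter_upwards [self_mem_nhdsWithin] with y hy
        simpa using hy
    exact ht.frequently (Filter.Eventually.of_forall hline).frequently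
  have hEq := hf_an.eqOn_of_preconnected_of_frequently_eq hg_an hUc hmem hfreq
  refine ⟨κ, fun ξ hξ => ?_⟩
  have h := hEq (show (ξ : ℂ) ∈ U from hξ)
  rw [complexMGF_recipMeasure hr] at h
  simp only [g] at h
  rw [← Complex.ofReal_sin, show (-(2 * s) : ℂ) = ((-(2 * s) : ℝ) : ℂ) by push_cast; ring,
    ← Complex.ofReal_cpow (Real.sin_pos_of_pos_of_lt_pi hξ.1 hξ.2).le, ← Complex.ofReal_mul] at h
  refine Complex.ofReal_injective (Eq.trans ?_ h)
  rw [← integral_complex_ofReal]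
  refine integral_congr_ae (Filter.Eventually.of_forall fun u => ?_)
  push_cast
  rw [mul_comm (u : ℂ)]

/-! ### Plancherel's theorem for Fourier integrals -/

-- Both transforms give the same integrals against smooth compactly supported functions: the
-- integral one by Fubini, the `L²` one through tempered distributions.
open FourierTransform SchwartzMap ContDiff in
theorem fourier_toLp_ae_eq {f : ℝ → ℂ} (hf : Integrable f) (hf2 : MemLp f 2) :
    ∀ᵐ x, 𝓕 f x = (𝓕 (hf2.toLp f) : Lp ℂ 2 (volume : Measure ℝ)) x := by
  have hcont : Continuous (𝓕 f) :=
    VectorFourier.fourierIntegral_continuous Real.continuous_fourierChar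
      (L := innerₗ ℝ) continuous_inner hf
  refine ae_eq_of_integral_contDiff_smul_eq hcont.locallyIntegrable
    ((Lp.memLp _).locallyIntegrable (by norm_num)) fun g hg hgc => ?_
  have hg₁ : HasCompactSupport (Complex.ofRealCLM ∘ g) := hgc.comp_left rfl
  have hg₂ : ContDiff ℝ ∞ (Complex.ofRealCLM ∘ g) := by fun_prop
  have h := DFunLike.congr_fun (Lp.fourier_toTemperedDistribution_eq (hf2.toLp f))
    (hg₁.toSchwartzMap hg₂)
  rw [TemperedDistribution.fourier_apply, Lp.toTemperedDistribution_apply,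
    Lp.toTemperedDistribution_apply] at h
  have h2 : ∫ x, (𝓕 (hg₁.toSchwartzMap hg₂)) x • (hf2.toLp f) x
      = ∫ x, (𝓕 (hg₁.toSchwartzMap hg₂)) x • f x := by
    refine integral_congr_ae ?_
    filter_upwards [hf2.coeFn_toLp] with x hx
    rw [hx]
  have h3 := VectorFourier.integral_fourierIntegral_smul_eq_flip (L := innerₗ ℝ)
    (μ := volume) (ν := volume) Real.continuous_fourierChar continuous_inner
    (hg₁.toSchwartzMap hg₂).integrable hf
  rw [flip_innerₗ] at h3
  have h4 : ∫ x, (𝓕 (hg₁.toSchwartzMap hg₂)) x • f x = ∫ x, (hg₁.toSchwartzMap hg₂) x • 𝓕 f x := h3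
  have h5 : ∀ F : ℝ → ℂ, ∫ x, (hg₁.toSchwartzMap hg₂) x • F x = ∫ x, g x • F x := fun F => by
    simp
  rw [← h5, ← h4, ← h2, h, h5]

theorem lintegral_enorm_sq_eq {α : Type*} [MeasurableSpace α] {μ : Measure α} (f : α → ℂ) :
    ∫⁻ x, ‖f x‖ₑ ^ 2 ∂μ = eLpNorm f 2 μ ^ 2 := by
  have h := eLpNorm_nnreal_pow_eq_lintegral (μ := μ) (f := f) (p := 2) two_ne_zero
  simpa using h.symm

open FourierTransform in
/-- Plancherel's theorem for functions in `L¹ ∩ L²`. -/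
theorem lintegral_enorm_fourier_sq {f : ℝ → ℂ} (hf : Integrable f) (hf2 : MemLp f 2) :
    ∫⁻ w, ‖𝓕 f w‖ₑ ^ 2 = ∫⁻ x, ‖f x‖ₑ ^ 2 := by
  have h1 : eLpNorm (𝓕 f) 2 volume
      = ‖(𝓕 (hf2.toLp f) : Lp ℂ 2 (volume : Measure ℝ))‖ₑ := by
    rw [Lp.enorm_def]
    exact eLpNorm_congr_ae (fourier_toLp_ae_eq hf hf2)
  rw [lintegral_enorm_sq_eq, lintegral_enorm_sq_eq, h1, ← ofReal_norm,
    Lp.norm_fourier_eq, Lp.norm_toLp, ENNReal.ofReal_toReal hf2.2.ne]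

theorem lintegral_comp_mul_left_real {a : ℝ} (ha : 0 < a) (g : ℝ → ENNReal) :
    ∫⁻ x, g x = ENNReal.ofReal a * ∫⁻ x, g (a * x) := by
  conv_lhs => rw [← Real.smul_map_volume_mul_left ha.ne']
  have h : MeasurableEmbedding (a * · : ℝ → ℝ) :=
    (Homeomorph.mulLeft₀ a ha.ne').measurableEmbedding
  rw [lintegral_smul_measure, abs_of_pos ha, smul_eq_mul, h.lintegral_map]

/-- Plancherel's theorem for the Fourier integral `∫ exp (-ipx/ħ) f(x) dx`. -/
theorem lintegral_enorm_integral_exp_sq {ħ : ℝ} (hħ : 0 < ħ) {f : ℝ → ℂ} (hf : Integrable f)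
    (hf2 : MemLp f 2) :
    ∫⁻ p : ℝ, ‖∫ x : ℝ, Complex.exp (-(Complex.I * p / ħ) * x) * f x‖ₑ ^ 2
      = ENNReal.ofReal (2 * Real.pi * ħ) * ∫⁻ x, ‖f x‖ₑ ^ 2 := by
  have hpi := Real.pi_pos
  rw [lintegral_comp_mul_left_real (a := 2 * Real.pi * ħ) (by positivity),
    ← lintegral_enorm_fourier_sq hf hf2]
  congr 1
  refine lintegral_congr fun w => ?_
  rw [Real.fourier_real_eq_integral_exp_smul]
  congr 3
  refine funext fun x => ?_
  rw [smul_eq_mul]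
  congr 2
  have : (ħ : ℂ) ≠ 0 := by exact_mod_cast hħ.ne'
  push_cast
  field_simp

/-! ### Densities of the coherent states -/

/-- The density `|η_{q,p}(x)|²` of a coherent state, with `s = ν + m + 1`. -/
def csDensity (L s q x : ℝ) : ℝ :=
  Real.pi / L * (Real.sin (Real.pi * x / L) ^ (2 * s)
    * Real.exp (-(2 * s) * Real.cot (Real.pi * q / L) * (Real.pi * x / L)))
    / sinExpIntReal (2 * s) (-(2 * s) * Real.cot (Real.pi * q / L))

theorem csDensity_nonneg {L s : ℝ} (hL : 0 < L) (hs : 0 ≤ s) (q : ℝ) {x : ℝ}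
    (hx : x ∈ Ioo (0 : ℝ) L) : 0 ≤ csDensity L s q x := by
  have := sin_pos_of_mem hx
  have := sinExpIntReal_pos (r := 2 * s) (by positivity) (-(2 * s) * Real.cot (Real.pi * q / L))
  have := Real.pi_pos
  unfold csDensity
  positivity

theorem measurable_csDensity {s : ℝ} (hs : 0 ≤ s) (L : ℝ) :
    Measurable fun z : ℝ × ℝ => csDensity L s z.1 z.2 := by
  have h1 : Measurable Real.cot := by
    rw [show Real.cot = fun t => Real.cos t / Real.sin t from
      funext fun t => Real.cot_eq_cos_div_sin t]
    fun_prop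
  have h2 : Measurable (sinExpIntReal (2 * s)) :=
    (continuous_sinExpIntReal (by positivity)).measurable
  have h3 : Measurable fun z : ℝ × ℝ => Real.cot (Real.pi * z.1 / L) := h1.comp (by fun_prop)
  have h4 : Measurable fun z : ℝ × ℝ => sinExpIntReal (2 * s)
    (-(2 * s) * Real.cot (Real.pi * z.1 / L)) := h2.comp (h3.const_mul _)
  have h5 : Measurable fun z : ℝ × ℝ => Real.sin (Real.pi * z.2 / L) ^ (2 * s) :=
    Measurable.pow_const (by fun_prop) _
  have h6 : Measurable fun z : ℝ × ℝ =>
      -(2 * s) * Real.cot (Real.pi * z.1 / L) * (Real.pi * z.2 / L) :=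
    (h3.const_mul _).mul (by fun_prop)
  exact ((h5.mul h6.exp).const_mul _).div h4

theorem lintegral_csDensity_right {L s : ℝ} (hL : 0 < L) (hs : 0 ≤ s) (q : ℝ) :
    ∫⁻ x in Ioo (0 : ℝ) L, ENNReal.ofReal (csDensity L s q x) = 1 := by
  set u := -(2 * s) * Real.cot (Real.pi * q / L) with hu
  have hpi := Real.pi_pos
  have hF := sinExpIntReal_pos (r := 2 * s) (by positivity) u
  have h1 : ∀ x, csDensity L s q x = Real.pi / L / sinExpIntReal (2 * s) u
      * (fun t => Real.sin t ^ (2 * s) * Real.exp (u * t)) (x * (Real.pi / L)) := by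
    intro x
    rw [csDensity, ← hu, show x * (Real.pi / L) = Real.pi * x / L by ring]
    ring
  have hc : Continuous fun x => csDensity L s q x := by
    rw [show (fun x => csDensity L s q x) = _ from funext h1]
    exact ((continuous_sinExpReal (by positivity) u).comp (by fun_prop)).const_mul _
  have hint : IntegrableOn (fun x => csDensity L s q x) (Ioo 0 L) :=
    (hc.continuousOn.integrableOn_Icc (a := 0) (b := L)).mono_set Ioo_subset_Icc_self
  rw [← ofReal_integral_eq_lintegral_ofReal hint (by
    filter_upwards [ae_restrict_mem measurableSet_Ioo] with x hx using
      csDensity_nonneg hL hs q hx), ← integral_Ioc_eq_integral_Ioo,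
    ← intervalIntegral.integral_of_le hL.le]
  simp only [h1]
  rw [intervalIntegral.integral_const_mul, intervalIntegral.integral_comp_mul_right
    (fun t => Real.sin t ^ (2 * s) * Real.exp (u * t)) (by positivity), zero_mul,
    mul_div_cancel₀ _ hL.ne', ← sinExpIntReal, smul_eq_mul]
  rw [← ENNReal.ofReal_one]
  congr 1
  field_simp

theorem cot_image {L s : ℝ} (hL : 0 < L) (hs : 0 < s) :
    InjOn (fun q => -(2 * s) * Real.cot (Real.pi * q / L)) (Ioo 0 L) ∧
      (fun q => -(2 * s) * Real.cot (Real.pi * q / L)) '' Ioo 0 L = univ := by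
  have hpi := Real.pi_pos
  constructor
  · have hd : ∀ q ∈ Ioo (0 : ℝ) L, HasDerivAt (fun q => -(2 * s) * Real.cot (Real.pi * q / L))
        (-(2 * s) * (-(1 + Real.cot (Real.pi * q / L) ^ 2) * (Real.pi / L))) q := fun q hq =>
      (hasDerivAt_cot_pi_mul_div hq).const_mul _
    refine (strictMonoOn_of_deriv_pos (convex_Ioo 0 L)
      (fun q hq => (hd q hq).continuousAt.continuousWithinAt) fun q hq => ?_).injOn
    rw [interior_Ioo] at hq
    rw [(hd q hq).deriv]
    have : 0 < 2 * s * ((1 + Real.cot (Real.pi * q / L) ^ 2) * (Real.pi / L)) := by positivity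
    linarith
  · refine eq_univ_of_forall fun u => ?_
    obtain ⟨q, hq, h⟩ := exists_cotVar_eq hL (-u / (2 * s))
    refine ⟨q, hq, ?_⟩
    simp only [h]
    field_simp

/-- Substitute `u = -2s cot(πq/L)`, which maps `(0,L)` bijectively onto the line. By the recurrence
the Jacobian replaces `F_{2s}` by `F_{2s-2}`, and the Laplace transform, a multiple of `sin^{-2s}
ξ`, cancels the factor `sin^{2s} ξ`. -/
theorem exists_lintegral_csDensity_left {L s : ℝ} (hL : 0 < L) (hs : 1 ≤ s) :
    ∃ κ : ENNReal, ∀ x ∈ Ioo (0 : ℝ) L,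
      ∫⁻ q in Ioo (0 : ℝ) L, ENNReal.ofReal (csDensity L s q x) = κ := by
  obtain ⟨κ, hκ⟩ := exists_integral_exp_div_eq hs
  have hr : 0 ≤ 2 * s - 2 := by linarith
  have hpi := Real.pi_pos
  have hs1 : 0 < 2 * s - 1 := by linarith
  refine ⟨ENNReal.ofReal (κ / (2 * s - 1)), fun x hx => ?_⟩
  set ξ := Real.pi * x / L with hξdef
  have hξ : ξ ∈ Ioo 0 Real.pi := by
    constructor
    · have := hx.1; positivity
    · rw [hξdef, div_lt_iff₀ hL]; exact mul_lt_mul_of_pos_left hx.2 hpi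
  have hsin : 0 < Real.sin ξ := sin_pos_of_mem hx
  obtain ⟨hinj, himg⟩ := cot_image hL (by linarith : 0 < s)
  have hcv := lintegral_image_eq_lintegral_abs_deriv_mul measurableSet_Ioo
    (fun q hq => ((hasDerivAt_cot_pi_mul_div hq).const_mul (-(2 * s))).hasDerivWithinAt) hinj
    (fun u => ENNReal.ofReal (Real.sin ξ ^ (2 * s) / (2 * s - 1)
      * (Real.exp (u * ξ) / sinExpIntReal (2 * s - 2) u)))
  rw [himg, Measure.restrict_univ, ← ofReal_integral_eq_lintegral_ofReal
    ((integrable_exp_div_sinExpIntReal hr hξ).const_mul _)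
    (Filter.Eventually.of_forall fun u => by
      have := sinExpIntReal_pos hr u
      positivity), integral_const_mul, hκ ξ hξ] at hcv
  have hconst : Real.sin ξ ^ (2 * s) / (2 * s - 1) * (κ * Real.sin ξ ^ (-(2 * s)))
      = κ / (2 * s - 1) := by
    rw [Real.rpow_neg hsin.le]
    have : Real.sin ξ ^ (2 * s) ≠ 0 := (Real.rpow_pos_of_pos hsin _).ne'
    field_simp
  rw [hconst] at hcv
  rw [hcv]
  refine setLIntegral_congr_fun measurableSet_Ioo fun q _ => ?_
  rw [← ENNReal.ofReal_mul (abs_nonneg _)]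
  congr 1
  set c := Real.cot (Real.pi * q / L)
  have h1 := sinExpIntReal_add_two hr (-(2 * s) * c)
  rw [show 2 * s - 2 + 2 = 2 * s by ring] at h1
  have h2 := sinExpIntReal_pos (r := 2 * s) (by linarith) (-(2 * s) * c)
  have h3 := sinExpIntReal_pos hr (-(2 * s) * c)
  have h4 : |-(2 * s) * (-(1 + c ^ 2) * (Real.pi / L))| = 2 * s * (1 + c ^ 2) * (Real.pi / L) := by
    rw [abs_of_nonneg]
    · ring
    · have : 0 ≤ 2 * s * ((1 + c ^ 2) * (Real.pi / L)) := by positivity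
      linarith
  rw [h4, csDensity, ← hξdef]
  change Real.pi / L * (Real.sin ξ ^ (2 * s) * Real.exp (-(2 * s) * c * ξ))
    / sinExpIntReal (2 * s) (-(2 * s) * c) = _
  -- For `u = -2sc` the factor `u² + (2s)²` of the recurrence is `4s²(1 + c²)`; divide by `2s`.
  have h5 : (1 + c ^ 2) * (2 * s) * sinExpIntReal (2 * s) (-(2 * s) * c)
      = (2 * s - 1) * sinExpIntReal (2 * s - 2) (-(2 * s) * c) := by
    have : 2 * s ≠ 0 := by positivity
    refine mul_left_cancel₀ this ?_
    linarith
  rw [div_eq_iff h2.ne']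
  generalize sinExpIntReal (2 * s) (-(2 * s) * c) = A at *
  generalize sinExpIntReal (2 * s - 2) (-(2 * s) * c) = B at *
  field_simp
  linear_combination (-1 : ℝ) * h5

/-- The densities of the coherent states form a resolution of the constant function `1`. -/
theorem lintegral_csDensity_left {L s : ℝ} (hL : 0 < L) (hs : 1 ≤ s) {x : ℝ}
    (hx : x ∈ Ioo (0 : ℝ) L) :
    ∫⁻ q in Ioo (0 : ℝ) L, ENNReal.ofReal (csDensity L s q x) = 1 := by
  obtain ⟨κ, hκ⟩ := exists_lintegral_csDensity_left hL hs
  rw [hκ x hx]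
  -- Tonelli on the square identifies the constant: integrating over `q` first gives `κL`, over `x`
  -- first gives `L` by normalization.
  have h1 : ∫⁻ x in Ioo (0 : ℝ) L, ∫⁻ q in Ioo (0 : ℝ) L, ENNReal.ofReal (csDensity L s q x)
      = κ * ENNReal.ofReal L := by
    rw [setLIntegral_congr_fun measurableSet_Ioo fun x hx => hκ x hx]
    simp
  have h2 : ∫⁻ q in Ioo (0 : ℝ) L, ∫⁻ x in Ioo (0 : ℝ) L, ENNReal.ofReal (csDensity L s q x)
      = 1 * ENNReal.ofReal L := by
    simp [lintegral_csDensity_right hL (by linarith : 0 ≤ s)]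
  rw [lintegral_lintegral_swap (measurable_csDensity (by linarith) L).ennreal_ofReal.aemeasurable,
    h1] at h2
  exact (ENNReal.mul_left_inj (by simpa using hL) ENNReal.ofReal_ne_top).mp h2

/-! ### Resolution of the identity -/

theorem norm_packet_sq {L s : ℝ} (hL : 0 < L) (hs : 0 ≤ s) (a : ℝ) :
    ‖packet L s a‖ ^ 2 = L / Real.pi * sinExpIntReal (2 * s) (2 * a * (L / Real.pi)) := by
  have h := inner_packet hL hs hs (a : ℂ) a
  rw [inner_self_eq_norm_sq_to_K, ← two_mul s, Complex.star_def, Complex.conj_ofReal,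
    show ((a : ℂ) + a) * (L / Real.pi) = ((2 * a * (L / Real.pi) : ℝ) : ℂ) by push_cast; ring,
    sinExpInt_ofReal] at h
  refine Complex.ofReal_injective ?_
  push_cast at h ⊢
  exact h

/-- At fixed `q`, the momentum enters only through `exp(ipx/ħ)`. The scalar product is therefore a
constant times the Fourier integral of `exp(ax) sin^s(πx/L) ψ(x)`, extended by zero outside `[0,L]`,
and Plancherel applies. -/
theorem lintegral_inner_cs_sq_slice {ħ M L ν β : ℝ} (hħ : 0 < ħ) (hM : 0 < M) (hL : 0 < L)
    (hν : 0 ≤ ν) (hβ : 0 ≤ β) (m : ℕ) {q : ℝ} (hq : q ∈ Ioo (0 : ℝ) L) (ψ : Hilb L) :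
    ∫⁻ p : ℝ, ‖inner ℂ (cs ħ M L ν β m q p) ψ‖ₑ ^ 2 = ENNReal.ofReal (2 * Real.pi * ħ)
      * ∫⁻ x in Ioo (0 : ℝ) L, ENNReal.ofReal (csDensity L (ν + m + 1) q x) * ‖ψ x‖ₑ ^ 2 := by
  obtain ⟨u, hu, h⟩ := exists_cs_eq hħ hM hL hν hβ m
  have hpi := Real.pi_pos
  set s := ν + m + 1 with hsdef
  have hs : 0 ≤ s := by positivity
  set a : ℝ := -(s * (Real.pi / L) * Real.cot (Real.pi * q / L)) with ha
  have hw : ∀ p, csExponent ħ L s q p = (a : ℂ) + Complex.I * p / ħ := fun p => rfl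
  set R : ℝ := ‖packet L s a‖⁻¹ with hR
  have hRp : ∀ p : ℝ, ‖packet L s (csExponent ħ L s q p)‖⁻¹ = R := fun p => by
    rw [hR, norm_packet_congr hL hs (w' := (a : ℂ))]
    simp [hw, Complex.div_ofReal_re]
  set f : ℝ → ℂ := (Icc (0 : ℝ) L).indicator fun x => expSin L s a x * ψ x with hf
  have hmem : MemLp (fun x => expSin L s a x * ψ x) 2 (volume.restrict (Icc (0 : ℝ) L)) := by
    obtain ⟨B, hB⟩ := isCompact_Icc.exists_bound_of_continuousOn (s := Icc (0 : ℝ) L)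
      (continuous_expSin hs L a).continuousOn
    refine (Lp.memLp ψ).of_le_mul (c := B)
      ((continuous_expSin hs L a).aestronglyMeasurable.mul (Lp.aestronglyMeasurable ψ)) ?_
    filter_upwards [ae_restrict_mem measurableSet_Icc] with x hx
    rw [norm_mul]
    gcongr
    exact hB x hx
  have hf2 : MemLp f 2 := (memLp_indicator_iff_restrict measurableSet_Icc).mpr hmem
  have hf1 : Integrable f :=
    (integrable_indicator_iff measurableSet_Icc).mpr (hmem.integrable (by norm_num))
  have hinner : ∀ p : ℝ, inner ℂ (packet L s (csExponent ħ L s q p)) ψ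
      = ∫ x : ℝ, Complex.exp (-(Complex.I * p / ħ) * x) * f x := by
    intro p
    have e : (fun x : ℝ => Complex.exp (-(Complex.I * p / ħ) * x) * f x) = (Icc (0 : ℝ) L).indicator
        fun x => Complex.exp (-(Complex.I * p / ħ) * x) * (expSin L s a x * ψ x) := by
      funext x
      by_cases hx : x ∈ Icc (0 : ℝ) L <;> simp [hf, hx]
    rw [e, integral_indicator measurableSet_Icc, L2.inner_def]
    refine integral_congr_ae ?_
    filter_upwards [coeFn_packet hs L (csExponent ħ L s q p)] with x hx
    rw [hx, RCLike.inner_apply, expSin, expSin, map_mul, Complex.conj_ofReal, ← Complex.exp_conj,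
      hw, map_mul, map_add, map_div₀, map_mul, Complex.conj_ofReal, Complex.conj_ofReal,
      Complex.conj_ofReal, Complex.conj_ofReal, Complex.conj_I,
      show ((a : ℂ) + -Complex.I * p / ħ) * x = -(Complex.I * p / ħ) * x + a * x by ring,
      Complex.exp_add]
    ring
  have hcs : ∀ p : ℝ, ‖inner ℂ (cs ħ M L ν β m q p) ψ‖ₑ ^ 2
      = ENNReal.ofReal (R ^ 2) * ‖∫ x : ℝ, Complex.exp (-(Complex.I * p / ħ) * x) * f x‖ₑ ^ 2 := by
    intro p
    rw [(h q hq p).2, inner_smul_left, hinner p, hRp p, enorm_mul, mul_pow]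
    congr 1
    rw [← ofReal_norm, RCLike.norm_conj, norm_mul, hu, one_mul, Complex.norm_real,
      Real.norm_of_nonneg (by positivity), ENNReal.ofReal_pow (by positivity)]
  simp only [hcs]
  rw [lintegral_const_mul' _ _ ENNReal.ofReal_ne_top, lintegral_enorm_integral_exp_sq hħ hf1 hf2,
    mul_left_comm, ← lintegral_const_mul' _ _ ENNReal.ofReal_ne_top]
  congr 1
  rw [show (fun x => ENNReal.ofReal (R ^ 2) * ‖f x‖ₑ ^ 2) = (Icc (0 : ℝ) L).indicator
    (fun x => ENNReal.ofReal (R ^ 2) * ‖expSin L s a x * ψ x‖ₑ ^ 2) from funext fun x => by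
      by_cases hx : x ∈ Icc (0 : ℝ) L <;> simp [hf, hx],
    lintegral_indicator measurableSet_Icc, ← setLIntegral_congr Ioo_ae_eq_Icc]
  refine setLIntegral_congr_fun measurableSet_Ioo fun x hx => ?_
  have hsin := sin_pos_of_mem hx
  rw [enorm_mul, mul_pow, ← mul_assoc]
  congr 1
  rw [← ofReal_norm, ← ENNReal.ofReal_pow (norm_nonneg _),
    ← ENNReal.ofReal_mul (sq_nonneg _)]
  congr 1
  have hu2 : 2 * a * (L / Real.pi) = -(2 * s) * Real.cot (Real.pi * q / L) := by
    rw [ha]; field_simp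
  have hF := sinExpIntReal_pos (r := 2 * s) (by positivity)
    (-(2 * s) * Real.cot (Real.pi * q / L))
  have hsq : Real.sin (Real.pi * x / L) ^ (2 * s) = (Real.sin (Real.pi * x / L) ^ s) ^ 2 := by
    rw [mul_comm 2 s, Real.rpow_mul hsin.le, Real.rpow_two]
  have hex : Real.exp (-(2 * s) * Real.cot (Real.pi * q / L) * (Real.pi * x / L))
      = Real.exp (a * x) ^ 2 := by
    rw [← Real.exp_nat_mul, ← hu2]
    congr 1
    push_cast
    field_simp
  rw [hR, inv_pow, norm_packet_sq hL hs, hu2, csDensity, hsq, hex, expSin, norm_mul,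
    Complex.norm_real, Real.norm_of_nonneg (Real.rpow_nonneg hsin.le _), ← Complex.ofReal_mul,
    Complex.norm_exp, Complex.ofReal_re]
  field_simp

theorem lintegral_inner_cs_sq {ħ M L ν β : ℝ} (hħ : 0 < ħ) (hM : 0 < M) (hL : 0 < L)
    (hν : 0 ≤ ν) (hβ : 0 ≤ β) (m : ℕ) (ψ : Hilb L) :
    ∫⁻ z in phaseSpace L, ‖inner ℂ (cs ħ M L ν β m z.1 z.2) ψ‖ₑ ^ 2
      = ENNReal.ofReal (2 * Real.pi * ħ) * ‖ψ‖ₑ ^ 2 := by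
  have hs : 1 ≤ ν + m + 1 := by
    have : 0 ≤ ν + m := by positivity
    linarith
  have hmeas : AEMeasurable (fun z : ℝ × ℝ => ‖inner ℂ (cs ħ M L ν β m z.1 z.2) ψ‖ₑ ^ 2)
      (volume.restrict (phaseSpace L)) :=
    (((continuousOn_cs hħ hM hL hν hβ m).inner (𝕜 := ℂ) continuousOn_const).aestronglyMeasurable
      (measurableSet_Ioo.prod MeasurableSet.univ)).enorm.pow_const 2
  have hvol : (volume : Measure (ℝ × ℝ)).restrict (phaseSpace L)
      = (volume.restrict (Ioo (0 : ℝ) L)).prod volume := by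
    rw [phaseSpace, Measure.volume_eq_prod, ← Measure.prod_restrict, Measure.restrict_univ]
  have hψ : AEMeasurable (fun x => ‖ψ x‖ₑ ^ 2) (volume.restrict (Ioo (0 : ℝ) L)) :=
    ((Lp.aestronglyMeasurable ψ).enorm.pow_const 2).mono_measure
      (Measure.restrict_mono Ioo_subset_Icc_self le_rfl)
  have hden : AEMeasurable (fun z : ℝ × ℝ => ENNReal.ofReal (csDensity L (ν + m + 1) z.1 z.2)
      * ‖ψ z.2‖ₑ ^ 2) ((volume.restrict (Ioo (0 : ℝ) L)).prod (volume.restrict (Ioo (0 : ℝ) L))) :=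
    (measurable_csDensity (by linarith) L).ennreal_ofReal.aemeasurable.mul
      (hψ.comp_quasiMeasurePreserving Measure.quasiMeasurePreserving_snd)
  rw [hvol] at hmeas ⊢
  rw [lintegral_prod _ hmeas, setLIntegral_congr_fun measurableSet_Ioo fun q hq =>
    lintegral_inner_cs_sq_slice hħ hM hL hν hβ m hq ψ, lintegral_const_mul' _ _
    ENNReal.ofReal_ne_top, lintegral_lintegral_swap hden]
  congr 1
  have h1 : ∀ x ∈ Ioo (0 : ℝ) L, ∫⁻ q in Ioo (0 : ℝ) L,
      ENNReal.ofReal (csDensity L (ν + m + 1) q x) * ‖ψ x‖ₑ ^ 2 = ‖ψ x‖ₑ ^ 2 := fun x hx => by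
    rw [lintegral_mul_const' _ _ (by finiteness), lintegral_csDensity_left hL hs hx, one_mul]
  rw [setLIntegral_congr_fun measurableSet_Ioo h1, setLIntegral_congr Ioo_ae_eq_Icc,
    lintegral_enorm_sq_eq, Lp.enorm_def]

theorem integrable_inner_cs_sq {ħ M L ν β : ℝ} (hħ : 0 < ħ) (hM : 0 < M) (hL : 0 < L)
    (hν : 0 ≤ ν) (hβ : 0 ≤ β) (m : ℕ) (ψ : Hilb L) :
    IntegrableOn (fun z : ℝ × ℝ => ‖inner ℂ (cs ħ M L ν β m z.1 z.2) ψ‖ ^ 2) (phaseSpace L) ∧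
      ∫ z in phaseSpace L, ‖inner ℂ (cs ħ M L ν β m z.1 z.2) ψ‖ ^ 2
        = 2 * Real.pi * ħ * ‖ψ‖ ^ 2 := by
  have hpi := Real.pi_pos
  have hmeas : AEStronglyMeasurable (fun z : ℝ × ℝ => ‖inner ℂ (cs ħ M L ν β m z.1 z.2) ψ‖ ^ 2)
      (volume.restrict (phaseSpace L)) :=
    (((continuousOn_cs hħ hM hL hν hβ m).inner (𝕜 := ℂ) continuousOn_const).norm.pow 2).aestronglyMeasurable
      (measurableSet_Ioo.prod MeasurableSet.univ)
  have hlin : ∫⁻ z in phaseSpace L, ENNReal.ofReal (‖inner ℂ (cs ħ M L ν β m z.1 z.2) ψ‖ ^ 2)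
      = ENNReal.ofReal (2 * Real.pi * ħ * ‖ψ‖ ^ 2) := by
    rw [ENNReal.ofReal_mul (by positivity), ENNReal.ofReal_pow (norm_nonneg _), ofReal_norm,
      ← lintegral_inner_cs_sq hħ hM hL hν hβ m ψ]
    refine lintegral_congr fun z => ?_
    rw [ENNReal.ofReal_pow (norm_nonneg _), ofReal_norm]
  have hnn : 0 ≤ᵐ[volume.restrict (phaseSpace L)]
      fun z : ℝ × ℝ => ‖inner ℂ (cs ħ M L ν β m z.1 z.2) ψ‖ ^ 2 :=
    Filter.Eventually.of_forall fun z => sq_nonneg _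
  refine ⟨⟨hmeas, ?_⟩, ?_⟩
  · rw [hasFiniteIntegral_iff_ofReal hnn, hlin]
    exact ENNReal.ofReal_lt_top
  · rw [integral_eq_lintegral_of_nonneg_ae hnn hmeas, hlin, ENNReal.toReal_ofReal (by positivity)]

theorem resolution_of_identity {ħ M L ν β : ℝ} (hħ : 0 < ħ) (hM : 0 < M) (hL : 0 < L)
    (hν : 0 ≤ ν) (hβ : 0 ≤ β) (m : ℕ) (φ ψ : Hilb L) :
    IntegrableOn (fun z : ℝ × ℝ => inner ℂ φ (cs ħ M L ν β m z.1 z.2)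
        * inner ℂ (cs ħ M L ν β m z.1 z.2) ψ) (phaseSpace L) volume ∧
      (1 / (2 * Real.pi * ħ) : ℂ) * ∫ z in phaseSpace L, inner ℂ φ (cs ħ M L ν β m z.1 z.2)
          * inner ℂ (cs ħ M L ν β m z.1 z.2) ψ = inner ℂ φ ψ := by
  set N : Hilb L → ℝ × ℝ → ℂ := fun χ z =>
    ((‖inner ℂ (cs ħ M L ν β m z.1 z.2) χ‖ ^ 2 : ℝ) : ℂ) with hN
  have hNi : ∀ χ, IntegrableOn (N χ) (phaseSpace L) := fun χ =>
    (integrable_inner_cs_sq hħ hM hL hν hβ m χ).1.ofReal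
  have hNI : ∀ χ, ∫ z in phaseSpace L, N χ z = 2 * Real.pi * ħ * (‖χ‖ : ℂ) ^ 2 := fun χ => by
    simp only [hN]
    rw [integral_complex_ofReal, (integrable_inner_cs_sq hħ hM hL hν hβ m χ).2]
    push_cast
    ring
  have hpol : (fun z : ℝ × ℝ => inner ℂ φ (cs ħ M L ν β m z.1 z.2)
      * inner ℂ (cs ħ M L ν β m z.1 z.2) ψ) = fun z => (N (φ + ψ) z - N (φ - ψ) z
        + (N (φ - Complex.I • ψ) z - N (φ + Complex.I • ψ) z) * Complex.I) / 4 := by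
    funext z
    -- Polarization of the two scalars `⟨η|φ⟩` and `⟨η|ψ⟩`, pointwise in `(q, p)`; the same identity
    -- in the Hilbert space reassembles the result.
    have h := inner_eq_sum_norm_sq_div_four (𝕜 := ℂ) (inner ℂ (cs ħ M L ν β m z.1 z.2) φ)
      (inner ℂ (cs ħ M L ν β m z.1 z.2) ψ)
    rw [RCLike.inner_apply, inner_conj_symm, mul_comm] at h
    rw [h]
    simp only [hN, inner_add_right, inner_sub_right, inner_smul_right]
    push_cast
    rfl
  have hd : ∀ χ₁ χ₂, IntegrableOn (fun z => N χ₁ z - N χ₂ z) (phaseSpace L) := fun χ₁ χ₂ =>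
    (hNi χ₁).sub (hNi χ₂)
  have hm : ∀ χ₁ χ₂, IntegrableOn (fun z => (N χ₁ z - N χ₂ z) * Complex.I) (phaseSpace L) :=
    fun χ₁ χ₂ => (hd χ₁ χ₂).mul_const _
  rw [hpol]
  refine ⟨((hd _ _).add (hm _ _)).div_const _, ?_⟩
  rw [integral_div, integral_add (hd _ _) (hm _ _), integral_mul_const,
    integral_sub (hNi _) (hNi _), integral_sub (hNi _) (hNi _), hNI, hNI, hNI, hNI]
  have h := inner_eq_sum_norm_sq_div_four (𝕜 := ℂ) φ ψ
  rw [h]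
  have h1 : (Real.pi : ℂ) ≠ 0 := by exact_mod_cast Real.pi_ne_zero
  have h2 : (ħ : ℂ) ≠ 0 := by exact_mod_cast hħ.ne'
  simp only [RCLike.I_to_complex, Complex.coe_algebraMap]
  field_simp

end PoschlTeller

end
theorem proposition6 (ħ M L ν β : ℝ) (hħ : 0 < ħ) (hM : 0 < M) (hL : 0 < L)
    (hν : 0 ≤ ν) (hβ : 0 ≤ β) (m : ℕ) :
    -- the coherent states are vectors of the Hilbert space, and eigenstates of `A_m`
    (∀ q p : ℝ, (q, p) ∈ PoschlTeller.phaseSpace L →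
      PoschlTeller.InDomainA ħ M L ν β m (PoschlTeller.csFun ħ M L ν β m q p) ∧
      ∀ x ∈ Ioo (0 : ℝ) L,
        PoschlTeller.opA ħ M L ν β m (PoschlTeller.csFun ħ M L ν β m q p) x
          = PoschlTeller.csLabel ħ M L ν β m q p * PoschlTeller.csFun ħ M L ν β m q p x) ∧
    -- they are normalized
    (∀ q p : ℝ, (q, p) ∈ PoschlTeller.phaseSpace L →
      inner ℂ (PoschlTeller.cs ħ M L ν β m q p) (PoschlTeller.cs ħ M L ν β m q p) = 1) ∧
    -- they are not orthogonal to each other, but for an explicit exceptional set of labels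
    (∀ ν' β' : ℝ, 0 ≤ ν' → 0 ≤ β' → ∀ q p q' p' : ℝ,
      (q, p) ∈ PoschlTeller.phaseSpace L → (q', p') ∈ PoschlTeller.phaseSpace L →
      (inner ℂ (PoschlTeller.cs ħ M L ν' β' m q' p') (PoschlTeller.cs ħ M L ν β m q p) = 0 ↔
        (ν + m + 1) * Real.cot (Real.pi * q / L)
            + (ν' + m + 1) * Real.cot (Real.pi * q' / L) = 0 ∧
        ∃ k : ℕ, |p - p'| * L = Real.pi * ħ * (ν + ν' + 2 * m + 4 + 2 * k))) ∧
    -- they depend continuously on `(q, p)`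
    ContinuousOn (fun z : ℝ × ℝ => PoschlTeller.cs ħ M L ν β m z.1 z.2)
      (PoschlTeller.phaseSpace L) ∧
    -- they resolve the identity
    (∀ φ ψ : PoschlTeller.Hilb L,
      IntegrableOn (fun z : ℝ × ℝ =>
        inner ℂ φ (PoschlTeller.cs ħ M L ν β m z.1 z.2)
          * inner ℂ (PoschlTeller.cs ħ M L ν β m z.1 z.2) ψ)
        (PoschlTeller.phaseSpace L) volume ∧
      (1 / (2 * Real.pi * ħ) : ℂ) * ∫ z in PoschlTeller.phaseSpace L,
        inner ℂ φ (PoschlTeller.cs ħ M L ν β m z.1 z.2)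
          * inner ℂ (PoschlTeller.cs ħ M L ν β m z.1 z.2) ψ
        = inner ℂ φ ψ) := by
  exact ⟨fun _ p hz => PoschlTeller.cs_eigen hħ hM hL hν hβ m hz.1 p,
    fun _ p hz => PoschlTeller.inner_cs_self hħ hM hL hν hβ m hz.1 p,
    fun _ _ hν' hβ' _ _ _ _ hz hz' =>
      PoschlTeller.inner_cs_eq_zero_iff hħ hM hL hν hβ hν' hβ' m hz.1 hz'.1,
    PoschlTeller.continuousOn_cs hħ hM hL hν hβ m,
    PoschlTeller.resolution_of_identity hħ hM hL hν hβ m⟩
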